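/- **Proposition (the Arnold relation).** Let $n\ge 1$ and let $\mathrm{Conf}_m(\mathbb C^n)=\{(\mathbf z^1,\dots,\mathbf z^m)\in(\mathbb C^n)^m : \mathbf z^a\neq \mathbf z^b \text{ for } a\neq b\}$. On $\mathbb C^n\setminus\{0\}$ consider the $(0,n-1)$-form $$\omega=(-1)^{\frac{n(n-1)}2+1}\frac{(n-1)!}{(2\pi i)^n}\frac1{|\mathbf z|^{2n}}\sum_{j=1}^n(-1)^j\,\bar z_j\,d\bar z_1\cdots\widehat{d\bar z_j}\cdots d\bar z_n ,$$ (so that $dz_1\cdots dz_n\,\omega$ is the Bochner–Martinelli kernel), and let $\omega_{ab}$ be the pullback of $\omega$ to $\mathrm{Conf}_m(\mathbb C^n)$ under $(\mathbf z^1,\dots,\mathbf z^m)\mapsto \mathbf z^a-\mathbf z^b$. Let $$F=\int_{\mathbf z^4}dz^4_1\cdots dz^4_n\,\omega_{14}\,\omega_{24}\,\omega_{34}$$ be the integral over the fibers of the projection $\mathrm{Conf}_4(\mathbb C^n)\to\mathrm{Conf}_3(\mathbb C^n)$, $(\mathbf z^1,\mathbf z^2,\mathbf z^3,\mathbf z^4)\mapsto(\mathbf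 z^1,\mathbf z^2,\mathbf z^3)$, where the fibers carry their standard complex orientation, that is, $\int_{\mathbf z^4} f\,dx_1\,dy_1\cdots dx_n\,dy_n\,\beta=\big(\int f\,dx_1\,dy_1\cdots dx_n\,dy_n\big)\beta$ for $z^4_j=x_j+iy_j$ and $\beta$ a product of differentials of the base coordinates. Then: 1. the $(0,2n-2)$-form $\omega_{12}\omega_{23}+\omega_{23}\omega_{31}+\omega_{31}\omega_{12}$ on $\mathrm{Conf}_3(\mathbb C^n)$ is $\bar\partial$-exact, i.e. it is $\bar\partial$ of a smooth $(0,2n-3)$-form (forms of negative degree being zero); 2. the integral defining $F$ converges absolutely over every fiber, $F$ is a smooth $(0,2n-3)$-form on $\mathrm{Conf}_3(\mathbb C^n)$, and $$\bar\partial F=(-1)^{n-1}\big(\omega_{12}\omega_{23}+\omega_{23}\omega_{31}+\omega_{31}\omega_{12}\big).$$ -/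

import Mathlib

open scoped ContDiff

noncomputable section

namespace DolbeaultConf

/-! ### Exterior algebra of the complexified cotangent space -/

/-- The complexified cotangent space `Hom_ℝ(E, ℂ)` of a real vector space `E`. -/
abbrev Cotangent (E : Type*) [AddCommGroup E] [Module ℝ E] : Type _ := E →ₗ[ℝ] ℂ

/-- The exterior algebra `Λ^•(E^* ⊗ ℂ)`, in which complex-valued differential forms on open subsets
of `E` take their values; multiplication is the wedge product. A differential form on an open set
`U ⊆ E` is represented by a function `E → Ext E`, of which only the values on `U` matter. -/
abbrev Ext (E : Type*) [AddCommGroup E] [Module ℝ E] : Type _ :=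
  ExteriorAlgebra ℂ (Cotangent E)

/-- A complex-valued covector as an element of degree one of the exterior algebra. -/
def covector {E : Type*} [AddCommGroup E] [Module ℝ E] (l : Cotangent E) : Ext E :=
  ExteriorAlgebra.ι ℂ l

/-- The algebra homomorphism `L^*` of exterior algebras given by precomposition with `L`. -/
def extComap {E F : Type*} [AddCommGroup E] [Module ℝ E] [AddCommGroup F] [Module ℝ F]
    (L : E →ₗ[ℝ] F) : Ext F →ₐ[ℂ] Ext E :=
  ExteriorAlgebra.map (LinearMap.lcomp ℂ ℂ L)

/-- Interior product `ι_v` with a tangent vector `v`: the antiderivation with `ι_v l = l v` for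
covectors `l`. -/
def interiorProd {E : Type*} [AddCommGroup E] [Module ℝ E] (v : E) : Ext E →ₗ[ℂ] Ext E :=
  CliffordAlgebra.contractLeft (Q := (0 : QuadraticForm ℂ (Cotangent E)))
    (LinearMap.applyₗ' (R := ℝ) ℂ v)

section Calculus

variable {E F : Type*}
  [NormedAddCommGroup E] [NormedSpace ℝ E] [FiniteDimensional ℝ E]
  [NormedAddCommGroup F] [NormedSpace ℝ F] [FiniteDimensional ℝ F]

/-- Linear coordinates on the finite-dimensional complex vector space `Ext E`. Smoothness,
derivatives and integrals of `Ext E`-valued functions are taken in these coordinates; the resulting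
notions do not depend on which linear coordinates are used. -/
def coord (E : Type*) [NormedAddCommGroup E] [NormedSpace ℝ E] [FiniteDimensional ℝ E] :
    Ext E ≃ₗ[ℂ] (Finset (Fin (Module.finrank ℂ (Cotangent E))) → ℂ) :=
  (Module.Basis.ExteriorAlgebra (Module.finBasis ℂ (Cotangent E))).equivFun

/-- The form `α` is smooth on `U`. -/
def SmoothFormOn (U : Set E) (α : E → Ext E) : Prop :=
  ContDiffOn ℝ ∞ (fun x => coord E (α x)) U

/-- The derivative at `x` of the coefficients of the form `α` in the direction `v`. -/
def coeffDeriv (α : E → Ext E) (x v : E) : Ext E :=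
  (coord E).symm (fderiv ℝ (fun y => coord E (α y)) x v)

/-- The pullback `f^*η` of a form `η`. -/
def pullback (f : E → F) (η : F → Ext F) (x : E) : Ext E :=
  extComap (fderiv ℝ f x : E →ₗ[ℝ] F) (η (f x))

end Calculus

/-! ### Dolbeault calculus on open subsets of `(ℂⁿ)^m`

A point of `(ℂⁿ)^m` is `x : Fin m → Fin n → ℂ`, with `x a i` the `i`-th coordinate of `z^a`. -/

/-- Complex conjugation as an `ℝ`-linear map. -/
def conjLin : ℂ →ₗ[ℝ] ℂ := Complex.conjAe.toLinearMap

variable {m n : ℕ}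

/-- The coordinate function `z^a_i` on `(ℂⁿ)^m`. -/
def coordFun (a : Fin m) (i : Fin n) : Cotangent (Fin m → Fin n → ℂ) :=
  LinearMap.proj i ∘ₗ LinearMap.proj a

/-- The form `dz^a_i` on `(ℂⁿ)^m`. -/
def dz (a : Fin m) (i : Fin n) : Ext (Fin m → Fin n → ℂ) := covector (coordFun a i)

/-- The form `dz̄^a_i` on `(ℂⁿ)^m`. -/
def dzbar (a : Fin m) (i : Fin n) : Ext (Fin m → Fin n → ℂ) :=
  covector (conjLin ∘ₗ coordFun a i)

/-- The tangent vector of `(ℂⁿ)^m` with entry `c` in the coordinate `z^a_i` and `0` elsewhere. -/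
def coordVec (a : Fin m) (i : Fin n) (c : ℂ) : Fin m → Fin n → ℂ :=
  Pi.single a (Pi.single i c)

/-- `∂α/∂z̄^a_i = (∂α/∂x^a_i + √-1 ∂α/∂y^a_i) / 2`, applied to coefficients. -/
def partialBar (a : Fin m) (i : Fin n) (α : (Fin m → Fin n → ℂ) → Ext (Fin m → Fin n → ℂ))
    (x : Fin m → Fin n → ℂ) : Ext (Fin m → Fin n → ℂ) :=
  (1 / 2 : ℂ) • (coeffDeriv α x (coordVec a i 1) +
    Complex.I • coeffDeriv α x (coordVec a i Complex.I))

/-- The Dolbeault differential `∂̄α = ∑ dz̄^a_i ∧ ∂α/∂z̄^a_i`. -/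
def dbar (α : (Fin m → Fin n → ℂ) → Ext (Fin m → Fin n → ℂ))
    (x : Fin m → Fin n → ℂ) : Ext (Fin m → Fin n → ℂ) :=
  ∑ a : Fin m, ∑ i : Fin n, dzbar a i * partialBar a i α x

/-- The space `Λ^{p,q}` spanned by the products of `p` forms `dz^a_i` and `q` forms `dz̄^a_i`;
it is zero if `p` or `q` is negative. -/
def bidegree (m n : ℕ) (p q : ℤ) : Submodule ℂ (Ext (Fin m → Fin n → ℂ)) :=
  if 0 ≤ p ∧ 0 ≤ q then
    Submodule.span ℂ (Set.range fun s : Fin m × Fin n => dz s.1 s.2) ^ p.toNat *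
      Submodule.span ℂ (Set.range fun s : Fin m × Fin n => dzbar s.1 s.2) ^ q.toNat
  else ⊥

/-- `α` is a smooth `(p,q)`-form on `U`, that is, `α ∈ A^{p,q}(U)`. -/
def IsForm (p q : ℤ) (U : Set (Fin m → Fin n → ℂ))
    (α : (Fin m → Fin n → ℂ) → Ext (Fin m → Fin n → ℂ)) : Prop :=
  SmoothFormOn U α ∧ ∀ x ∈ U, α x ∈ bidegree m n p q

/-- The `(p,q)`-form `α` on `U` is `∂̄`-exact: `α = ∂̄β` on `U` with `β ∈ A^{p,q-1}(U)`. -/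
def IsDbarExact (p q : ℤ) (U : Set (Fin m → Fin n → ℂ))
    (α : (Fin m → Fin n → ℂ) → Ext (Fin m → Fin n → ℂ)) : Prop :=
  ∃ β : (Fin m → Fin n → ℂ) → Ext (Fin m → Fin n → ℂ),
    IsForm p (q - 1) U β ∧ ∀ x ∈ U, dbar β x = α x

/-! ### Configuration spaces and fiber integration -/

/-- The configuration space `Conf_m(ℂⁿ)`, an open subset of `(ℂⁿ)^m`. -/
def Conf (m n : ℕ) : Set (Fin m → Fin n → ℂ) := {x | ∀ a b : Fin m, a ≠ b → x a ≠ x b}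

/-- The point `(z^1, …, z^m, z)` of `(ℂⁿ)^{m+1}`. -/
def addPoint (x : Fin m → Fin n → ℂ) (z : Fin n → ℂ) : Fin (m + 1) → Fin n → ℂ :=
  Fin.snoc (α := fun _ => Fin n → ℂ) x z

/-- The inclusion of tangent vectors of the base `v ↦ (v, 0)`. -/
def horizontal (m n : ℕ) : (Fin m → Fin n → ℂ) →ₗ[ℝ] (Fin (m + 1) → Fin n → ℂ) where
  toFun v := addPoint v 0
  map_add' v w := by
    funext a
    refine Fin.lastCases ?_ (fun b => ?_) a <;> simp [addPoint]
  map_smul' c v := by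
    funext a
    refine Fin.lastCases ?_ (fun b => ?_) a <;> simp [addPoint]

/-- Evaluation of a form on `(ℂⁿ)^{m+1}` on the standard positively oriented real basis
`e_1, √-1 e_1, …, e_n, √-1 e_n` of the last factor `ℂⁿ` (inserted in the first `2n` slots),
restricted to tangent vectors of the base `(ℂⁿ)^m` in the remaining slots. -/
def fiberComponent (η : Ext (Fin (m + 1) → Fin n → ℂ)) : Ext (Fin m → Fin n → ℂ) :=
  extComap (horizontal m n)
    ((List.finRange n).foldl
      (fun ξ i => interiorProd (coordVec (Fin.last m) i Complex.I)
        (interiorProd (coordVec (Fin.last m) i 1) ξ)) η)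

/-- The fiber of `Conf_{m+1}(ℂⁿ) → Conf_m(ℂⁿ)` over `x`. -/
def fiber (x : Fin m → Fin n → ℂ) : Set (Fin n → ℂ) := {z | addPoint x z ∈ Conf (m + 1) n}

/-- The integral over the fiber through `x` of the form `η` on `Conf_{m+1}(ℂⁿ)` converges
absolutely. -/
def FiberIntegrable (η : (Fin (m + 1) → Fin n → ℂ) → Ext (Fin (m + 1) → Fin n → ℂ))
    (x : Fin m → Fin n → ℂ) : Prop :=
  MeasureTheory.IntegrableOn
    (fun z => coord (Fin m → Fin n → ℂ) (fiberComponent (η (addPoint x z)))) (fiber x)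

/-- The fiber integral along `Conf_{m+1}(ℂⁿ) → Conf_m(ℂⁿ)`,
`∫_{z^{m+1}} (f dx_1 ∧ dy_1 ∧ ⋯ ∧ dx_n ∧ dy_n) ∧ β = (∫ f) β`, where `x_i + √-1 y_i = z^{m+1}_i`
and `β` is a constant form in the base variables. -/
def fiberIntegral (η : (Fin (m + 1) → Fin n → ℂ) → Ext (Fin (m + 1) → Fin n → ℂ))
    (x : Fin m → Fin n → ℂ) : Ext (Fin m → Fin n → ℂ) :=
  (coord (Fin m → Fin n → ℂ)).symm
    (∫ z in fiber x, coord (Fin m → Fin n → ℂ) (fiberComponent (η (addPoint x z))))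

/-! ### The Bochner-Martinelli form -/

/-- The form `dz̄_1 ⋯ \widehat{dz̄_i} ⋯ dz̄_n` on `ℂⁿ`. -/
def dzbarOmit (i : Fin n) : Ext (Fin n → ℂ) :=
  (((List.finRange n).filter (fun k => k ≠ i)).map
    fun k => covector (conjLin ∘ₗ (LinearMap.proj k : Cotangent (Fin n → ℂ)))).prod

/-- The `(0,n-1)`-form on `ℂⁿ ∖ {0}`
`ω = (-1)^{n(n-1)/2+1} (n-1)!/(2π√-1)^n |z|^{-2n} ∑_{i=1}^n (-1)^i z̄_i dz̄_1 ⋯ \widehat{dz̄_i} ⋯ dz̄_n`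
(the index `i` of the sum starts from `0` in the code). -/
def bmForm (n : ℕ) (z : Fin n → ℂ) : Ext (Fin n → ℂ) :=
  ((-1) ^ (n * (n - 1) / 2 + 1) * ((n - 1).factorial : ℂ) / (2 * Real.pi * Complex.I) ^ n *
      (1 / ((∑ k, ‖z k‖ ^ 2 : ℝ) : ℂ) ^ n)) •
    ∑ i : Fin n, ((-1) ^ ((i : ℕ) + 1) * (starRingEnd ℂ) (z i)) • dzbarOmit i

/-- `ω_{ab}`, the pullback of `ω` under `(z^1, …, z^m) ↦ z^a - z^b`. -/
def omegaPair (a b : Fin m) : (Fin m → Fin n → ℂ) → Ext (Fin m → Fin n → ℂ) :=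
  pullback (fun x => x a - x b) (bmForm n)

/-- `ω_{12} ω_{23} + ω_{23} ω_{31} + ω_{31} ω_{12}` on `Conf_3(ℂⁿ)`. -/
def arnoldForm (n : ℕ) (x : Fin 3 → Fin n → ℂ) : Ext (Fin 3 → Fin n → ℂ) :=
  omegaPair 0 1 x * omegaPair 1 2 x + omegaPair 1 2 x * omegaPair 2 0 x +
    omegaPair 2 0 x * omegaPair 0 1 x

/-- `dz^4_1 ⋯ dz^4_n ω_{14} ω_{24} ω_{34}` on `Conf_4(ℂⁿ)`. -/
def arnoldKernel (n : ℕ) (x : Fin 4 → Fin n → ℂ) : Ext (Fin 4 → Fin n → ℂ) :=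
  ((List.finRange n).map fun i => dz (3 : Fin 4) i).prod *
    (omegaPair 0 3 x * omegaPair 1 3 x * omegaPair 2 3 x)

end DolbeaultConf

end

set_option linter.unusedSectionVars false

open scoped ContDiff

namespace DolbeaultConf

open MeasureTheory Set Filter Topology

/-! ### Parametric integrals with compact parameter -/

section ParametricIntegral

variable {Z P X : Type} [MeasurableSpace Z] {μ : Measure Z}
  [NormedAddCommGroup P] [NormedSpace ℝ P] [MeasurableSpace P] [BorelSpace P]
  [SecondCountableTopology P]
  [NormedAddCommGroup X] [NormedSpace ℝ X] [FiniteDimensional ℝ X]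
  {w : Z → ℂ} {π : Z → P} {K : Set P}

/-! Put K_j(z) = z̄_j/|z|^{2n}. Each ω_{ab} is a sum over j of a constant times K_j(z^a − z^b) times
a constant form, the wedge of the dz̄^a_k − dz̄^b_k with k ≠ j. Hence F is a finite sum of constant
forms with coefficients I_{jkl}(x) = ∫ K_j(x_1 − z) K_k(x_2 − z) K_l(x_3 − z) dz, and the theorem
splits into analysis of these scalar integrals and exterior algebra of the constant forms.

Analysis. K_j is locally integrable, being O(|z|^{1−2n}) in real dimension 2n, and the triple
product decays like |z|^{3−6n}, so I_{jkl} converges. It is smooth in x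
(`contDiffOn_kernelIntegral`): near z = x_a the substitution z ↦ x_a − z makes the singular factor
independent of x, and away from the x_a homogeneity of K reduces the integral to one over a compact
parameter space against an integrable weight. The Bochner–Martinelli identity ∑_j ∂K_j/∂z̄_j =
π^n/(n−1)! · δ_0 is obtained from the regularisation z̄_j/(|z|² + ε)^n. It gives
`sum_wirtinger_kernelIntegral`: the divergence of I in the point x_a is π^n/(n−1)! times the product
of the two other kernels evaluated at z = x_a.

Algebra. I is translation invariant, so ∑_a ∂I/∂z̄^a_i = 0, and in ∂̄F every dz̄^a_i may be
replaced, under the fiber integral, by dz̄^a_i − dz̄^4_i. Wedged with the factor of ω_{a4} omitting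
j this gives zero unless i = j, so only the divergence in x_a survives. The full product of the
dz̄^a_k − dz̄^4_k that results turns the other factors dz̄^b − dz̄^4 into dz̄^b − dz̄^a. The point a
thus contributes, up to sign, the product of the two ω_{ba}, b ≠ a (`boundaryTerm_zero`,
`boundaryTerm_one`, `boundaryTerm_two`); the normalisation of ω makes the constant 1, and ω_{ba} =
(−1)^n ω_{ab} with graded commutativity gives the sign.

The exactness claim follows with primitive (−1)^{n−1}F. For n = 1 the form F has degree −1 and
vanishes, and the same computation shows that the Arnold form is zero. -/

theorem aestronglyMeasurable_smul_comp {G : Type} [NormedAddCommGroup G] [NormedSpace ℂ G]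
    (hw : Integrable w μ) (hπ : Measurable π) (hK : IsCompact K) (hwK : ∀ z, w z ≠ 0 → π z ∈ K)
    {f : P → G} (hf : ContinuousOn f K) :
    AEStronglyMeasurable (fun z => w z • f (π z)) μ := by
  have h1 : AEStronglyMeasurable (K.indicator f) (μ.map π) :=
    (aestronglyMeasurable_indicator_iff hK.measurableSet).2
      (hf.aestronglyMeasurable hK.measurableSet)
  have h2 := hw.aestronglyMeasurable.smul (h1.comp_measurable hπ)
  refine h2.congr (Eventually.of_forall fun z => ?_)
  by_cases hz : w z = 0
  · simp [hz]
  · simp [indicator_of_mem (hwK z hz)]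

theorem integrable_smul_comp {G : Type} [NormedAddCommGroup G] [NormedSpace ℂ G]
    (hw : Integrable w μ) (hπ : Measurable π) (hK : IsCompact K) (hwK : ∀ z, w z ≠ 0 → π z ∈ K)
    {f : P → G} (hf : ContinuousOn f K) :
    Integrable (fun z => w z • f (π z)) μ := by
  obtain ⟨C, hC⟩ := hK.exists_bound_of_continuousOn hf
  refine (hw.norm.mul_const C).mono' (aestronglyMeasurable_smul_comp hw hπ hK hwK hf)
    (Eventually.of_forall fun z => ?_)
  by_cases hz : w z = 0
  · simp [hz]
  · rw [norm_smul]
    exact mul_le_mul_of_nonneg_left (hC _ (hwK z hz)) (norm_nonneg _)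

/-- The derivative of `h` in the first variable. -/
noncomputable def fderivFst {G : Type} [NormedAddCommGroup G] [NormedSpace ℝ G] (h : X × P → G) (p : X × P) :
    X →L[ℝ] G :=
  (fderiv ℝ h p).comp (ContinuousLinearMap.inl ℝ X P)

variable {U : Set X} {O : Set (X × P)}

theorem contDiffOn_fderivFst {G : Type} [NormedAddCommGroup G] [NormedSpace ℝ G] {h : X × P → G}
    (hO : IsOpen O) (hh : ContDiffOn ℝ ∞ h O) : ContDiffOn ℝ ∞ (fderivFst h) O := by
  have h1 : ContDiffOn ℝ ∞ (fderiv ℝ h) O := hh.fderiv_of_isOpen hO (by simp)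
  exact h1.clm_comp contDiffOn_const

theorem hasFDerivAt_fderivFst {G : Type} [NormedAddCommGroup G] [NormedSpace ℝ G] {h : X × P → G}
    (hO : IsOpen O) (hh : ContDiffOn ℝ ∞ h O) {x : X} {p : P} (hx : (x, p) ∈ O) :
    HasFDerivAt (fun y => h (y, p)) (fderivFst h (x, p)) x := by
  have h1 : HasFDerivAt h (fderiv ℝ h (x, p)) (x, p) :=
    ((hh.contDiffAt (hO.mem_nhds hx)).differentiableAt (by simp)).hasFDerivAt
  exact h1.comp x (hasFDerivAt_prodMk_left x p)

/-- All singularity and decay of the integrand sits in the fixed integrable weight `w`. The factor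
`h` carrying the parameter has derivative bounded on (closed ball) × `K`, so dominated
differentiation applies. -/
theorem hasFDerivAt_integral_smul_comp {G : Type} [NormedAddCommGroup G] [NormedSpace ℂ G]
    [CompleteSpace G] (hw : Integrable w μ) (hπ : Measurable π) (hK : IsCompact K)
    (hwK : ∀ z, w z ≠ 0 → π z ∈ K) (hU : IsOpen U) (hO : IsOpen O) (hUO : U ×ˢ K ⊆ O)
    {h : X × P → G} (hh : ContDiffOn ℝ ∞ h O) {x : X} (hx : x ∈ U) :
    HasFDerivAt (fun y => ∫ z, w z • h (y, π z) ∂μ) (∫ z, w z • fderivFst h (x, π z) ∂μ) x := by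
  have hmaps : ∀ y ∈ U, MapsTo (fun p : P => (y, p)) K O := fun y hy p hp => hUO ⟨hy, hp⟩
  have hc : ∀ y ∈ U, ContinuousOn (fun p => h (y, p)) K := fun y hy =>
    hh.continuousOn.comp (by fun_prop) (hmaps y hy)
  have hc' : ContinuousOn (fun p => fderivFst h (x, p)) K :=
    (contDiffOn_fderivFst hO hh).continuousOn.comp (by fun_prop) (hmaps x hx)
  obtain ⟨δ, hδ, hδU⟩ := Metric.nhds_basis_closedBall.mem_iff.1 (hU.mem_nhds hx)
  have hcomp : IsCompact (Metric.closedBall x δ ×ˢ K) := (isCompact_closedBall x δ).prod hK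
  have hsub : Metric.closedBall x δ ×ˢ K ⊆ O := (prod_mono hδU subset_rfl).trans hUO
  obtain ⟨C, hC⟩ := hcomp.exists_bound_of_continuousOn
    ((contDiffOn_fderivFst hO hh).continuousOn.mono hsub)
  refine hasFDerivAt_integral_of_dominated_of_fderiv_le (𝕜 := ℝ)
    (s := Metric.closedBall x δ) (bound := fun z => ‖w z‖ * C)
    (F' := fun y z => w z • fderivFst h (y, π z)) (Metric.closedBall_mem_nhds x hδ)
    ?_ (integrable_smul_comp hw hπ hK hwK (hc x hx))
    (aestronglyMeasurable_smul_comp hw hπ hK hwK hc') ?_ (hw.norm.mul_const C) ?_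
  · filter_upwards [hU.mem_nhds hx] with y hy
    exact aestronglyMeasurable_smul_comp hw hπ hK hwK (hc y hy)
  · refine Eventually.of_forall fun z y hy => ?_
    by_cases hz : w z = 0
    · simp [hz]
    · rw [norm_smul]
      exact mul_le_mul_of_nonneg_left (hC (y, π z) ⟨hy, hwK z hz⟩) (norm_nonneg _)
  · refine Eventually.of_forall fun z y hy => ?_
    by_cases hz : w z = 0
    · simpa [hz] using hasFDerivAt_const (0 : G) y
    · exact (hasFDerivAt_fderivFst hO hh (hsub (a := (y, π z)) ⟨hy, hwK z hz⟩)).const_smul (w z)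

theorem contDiffOn_integral_smul_comp {G : Type} [NormedAddCommGroup G] [NormedSpace ℂ G]
    [CompleteSpace G] (hw : Integrable w μ) (hπ : Measurable π) (hK : IsCompact K)
    (hwK : ∀ z, w z ≠ 0 → π z ∈ K) (hU : IsOpen U) (hO : IsOpen O) (hUO : U ×ˢ K ⊆ O)
    {h : X × P → G} (hh : ContDiffOn ℝ ∞ h O) :
    ContDiffOn ℝ ∞ (fun y => ∫ z, w z • h (y, π z) ∂μ) U := by
  rw [contDiffOn_infty]
  intro k
  -- The derivative is an integral of the same shape with values in `X →L[ℝ] G`, so the induction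
  -- must range over all target spaces.
  induction k generalizing G with
  | zero =>
    refine contDiffOn_zero.2 fun x hx => ?_
    exact (hasFDerivAt_integral_smul_comp hw hπ hK hwK hU hO hUO hh
      hx).continuousAt.continuousWithinAt
  | succ k ih =>
    have hd := fun x (hx : x ∈ U) => hasFDerivAt_integral_smul_comp hw hπ hK hwK hU hO hUO hh hx
    push_cast
    rw [contDiffOn_succ_iff_fderiv_of_isOpen hU]
    refine ⟨fun x hx => (hd x hx).differentiableAt.differentiableWithinAt, by simp, ?_⟩
    exact (ih (contDiffOn_fderivFst hO hh)).congr fun x hx => (hd x hx).fderiv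

end ParametricIntegral

/-! ### The regularised Bochner-Martinelli kernel -/

section Kernel

variable {n : ℕ}

/-- `|z|² = ∑ |z_k|²`. -/
noncomputable def sqNorm (z : Fin n → ℂ) : ℝ := ∑ k, ‖z k‖ ^ 2

/-- `z̄_j / (|z|² + ε)^n`. -/
noncomputable def bmKernel (ε : ℝ) (j : Fin n) (z : Fin n → ℂ) : ℂ :=
  (starRingEnd ℂ) (z j) / ((sqNorm z + ε : ℝ) : ℂ) ^ n

/-- `∂f/∂z̄_j`. -/
noncomputable def wirtingerBar (j : Fin n) (f : (Fin n → ℂ) → ℂ) (z : Fin n → ℂ) : ℂ :=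
  (1 / 2 : ℂ) * (fderiv ℝ f z (Pi.single j 1) + Complex.I * fderiv ℝ f z (Pi.single j Complex.I))

theorem sqNorm_nonneg (z : Fin n → ℂ) : 0 ≤ sqNorm z := Finset.sum_nonneg fun _ _ => by positivity

theorem sq_norm_le_sqNorm (z : Fin n → ℂ) : ‖z‖ ^ 2 ≤ sqNorm z := by
  have h : ‖z‖ ≤ √(sqNorm z) := by
    refine (pi_norm_le_iff_of_nonneg (Real.sqrt_nonneg _)).2 fun k => ?_
    refine Real.le_sqrt_of_sq_le ?_
    exact Finset.single_le_sum (f := fun k => ‖z k‖ ^ 2) (fun _ _ => by positivity)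
      (Finset.mem_univ k)
  calc ‖z‖ ^ 2 ≤ √(sqNorm z) ^ 2 := by gcongr
    _ = sqNorm z := Real.sq_sqrt (sqNorm_nonneg z)

theorem sqNorm_le (z : Fin n → ℂ) : sqNorm z ≤ n * ‖z‖ ^ 2 := by
  calc sqNorm z ≤ ∑ _k : Fin n, ‖z‖ ^ 2 :=
        Finset.sum_le_sum fun k _ => by gcongr; exact norm_le_pi_norm z k
    _ = n * ‖z‖ ^ 2 := by simp

theorem sqNorm_pos {z : Fin n → ℂ} (hz : z ≠ 0) : 0 < sqNorm z :=
  lt_of_lt_of_le (by have := norm_pos_iff.2 hz; positivity) (sq_norm_le_sqNorm z)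

theorem sqNorm_smul (t : ℝ) (z : Fin n → ℂ) : sqNorm (t • z) = t ^ 2 * sqNorm z := by
  simp only [sqNorm, Finset.mul_sum, Pi.smul_apply, norm_smul, mul_pow, Real.norm_eq_abs, sq_abs]

theorem contDiff_sqNorm : ContDiff ℝ ∞ (sqNorm (n := n)) := by
  refine ContDiff.sum fun k _ => ?_
  exact (contDiff_norm_sq ℝ).comp (contDiff_apply ℝ ℂ k)

theorem contDiff_conj_apply (j : Fin n) :
    ContDiff ℝ ∞ fun z : Fin n → ℂ => (starRingEnd ℂ) (z j) :=
  Complex.conjCLE.contDiff.comp (contDiff_apply ℝ ℂ j)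

theorem contDiffAt_bmKernel {ε : ℝ} (j : Fin n) {z : Fin n → ℂ} (hz : sqNorm z + ε ≠ 0) :
    ContDiffAt ℝ ∞ (bmKernel ε j) z := by
  have h1 : ContDiff ℝ ∞ fun z : Fin n → ℂ => ((sqNorm z + ε : ℝ) : ℂ) :=
    Complex.ofRealCLM.contDiff.comp (contDiff_sqNorm.add contDiff_const)
  have h2 : ContDiffAt ℝ ∞ (fun z : Fin n → ℂ => (((sqNorm z + ε : ℝ) : ℂ) ^ n)⁻¹) z :=
    ContDiffAt.fun_inv (h1.pow n).contDiffAt (pow_ne_zero n (by exact_mod_cast hz))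
  simpa only [bmKernel, div_eq_mul_inv] using! (contDiff_conj_apply j).contDiffAt.mul h2

theorem contDiffAt_bmKernel_zero (j : Fin n) {z : Fin n → ℂ} (hz : z ≠ 0) :
    ContDiffAt ℝ ∞ (bmKernel 0 j) z :=
  contDiffAt_bmKernel j (by simpa using (sqNorm_pos hz).ne')

theorem contDiff_bmKernel {ε : ℝ} (hε : 0 < ε) (j : Fin n) : ContDiff ℝ ∞ (bmKernel ε j) :=
  contDiff_iff_contDiffAt.2 fun z => contDiffAt_bmKernel j (by have := sqNorm_nonneg z; positivity)

theorem fderiv_sqNorm_single (z : Fin n → ℂ) (j : Fin n) (c : ℂ) :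
    fderiv ℝ (fun z : Fin n → ℂ => ((sqNorm z : ℝ) : ℂ)) z (Pi.single j c) =
      (starRingEnd ℂ) (z j) * c + z j * (starRingEnd ℂ) c := by
  have h1 : (fun z : Fin n → ℂ => ((sqNorm z : ℝ) : ℂ)) =
      fun z => ∑ k, (starRingEnd ℂ) (z k) * z k := by
    funext z
    simp [sqNorm, Complex.conj_mul']
  have h2 : ∀ k, HasFDerivAt (fun z : Fin n → ℂ => (starRingEnd ℂ) (z k) * z k) _ z := fun k =>
    ((Complex.conjCLE.hasFDerivAt (x := z k)).comp z (hasFDerivAt_apply (𝕜 := ℝ) k z)).mul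
      (hasFDerivAt_apply (𝕜 := ℝ) k z)
  rw [h1, (HasFDerivAt.fun_sum fun k _ => h2 k).fderiv, _root_.sum_apply,
    Finset.sum_eq_single j]
  · simp
  · intro k _ hk
    simp [Pi.single_eq_of_ne hk]
  · simp

theorem fderiv_bmKernel_single {ε : ℝ} (i j : Fin n) {z : Fin n → ℂ} (hz : sqNorm z + ε ≠ 0)
    (c : ℂ) :
    fderiv ℝ (bmKernel ε i) z (Pi.single j c) =
      (if i = j then (starRingEnd ℂ) c else 0) / ((sqNorm z + ε : ℝ) : ℂ) ^ n -
        n * (starRingEnd ℂ) (z i) * ((starRingEnd ℂ) (z j) * c + z j * (starRingEnd ℂ) c) /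
          ((sqNorm z + ε : ℝ) : ℂ) ^ (n + 1) := by
  have hne : ((sqNorm z + ε : ℝ) : ℂ) ≠ 0 := by exact_mod_cast hz
  have hq : HasFDerivAt (fun z : Fin n → ℂ => ((sqNorm z + ε : ℝ) : ℂ))
      (fderiv ℝ (fun z : Fin n → ℂ => ((sqNorm z : ℝ) : ℂ)) z) z := by
    have : DifferentiableAt ℝ (fun z : Fin n → ℂ => ((sqNorm z : ℝ) : ℂ)) z :=
      (Complex.ofRealCLM.contDiff.comp contDiff_sqNorm).contDiffAt.differentiableAt
        (n := ∞) (by simp)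
    simpa using this.hasFDerivAt.add_const (ε : ℂ)
  have hi : HasFDerivAt (fun z : Fin n → ℂ => (starRingEnd ℂ) (z i)) _ z :=
    (Complex.conjCLE.hasFDerivAt (x := z i)).comp z (hasFDerivAt_apply (𝕜 := ℝ) i z)
  have hpow : HasDerivAt (fun u : ℂ => (u ^ n)⁻¹) _ ((sqNorm z + ε : ℝ) : ℂ) :=
    (hasDerivAt_pow n _).fun_inv (pow_ne_zero n hne)
  have hinv : HasFDerivAt (fun z : Fin n → ℂ => (((sqNorm z + ε : ℝ) : ℂ) ^ n)⁻¹) _ z :=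
    HasFDerivAt.comp (g := fun u : ℂ => (u ^ n)⁻¹) z (hpow.hasFDerivAt.restrictScalars ℝ) hq
  have e : bmKernel ε i = fun z => (starRingEnd ℂ) (z i) * (((sqNorm z + ε : ℝ) : ℂ) ^ n)⁻¹ := by
    funext z; rw [bmKernel, div_eq_mul_inv]
  rw [e, (hi.fun_mul hinv).fderiv]
  have hs := fderiv_sqNorm_single z j c
  simp only [_root_.add_apply, _root_.smul_apply, hs,
    ContinuousLinearMap.comp_apply, smul_eq_mul]
  have hp : (Pi.single j c : Fin n → ℂ) i = if i = j then c else 0 := Pi.single_apply j c i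
  generalize ((sqNorm z + ε : ℝ) : ℂ) = u at hne
  have hu : -((n : ℂ) * u ^ (n - 1)) / (u ^ n) ^ 2 = -n / u ^ (n + 1) := by
    obtain ⟨k, rfl⟩ : ∃ k, n = k + 1 := ⟨n - 1, by have := i.pos; omega⟩
    rw [Nat.add_sub_cancel]
    field_simp
    ring
  rw [hu]
  simp only [ContinuousLinearMap.coe_restrictScalars', ContinuousLinearMap.toSpanSingleton_apply,
    ContinuousLinearMap.proj_apply, hp, ContinuousLinearEquiv.coe_coe, Complex.conjCLE_apply,
    smul_eq_mul]
  split_ifs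
  · ring
  · rw [map_zero]
    ring

theorem wirtingerBar_bmKernel {ε : ℝ} (i j : Fin n) {z : Fin n → ℂ} (hz : sqNorm z + ε ≠ 0) :
    wirtingerBar j (bmKernel ε i) z = (if i = j then 1 else 0) / ((sqNorm z + ε : ℝ) : ℂ) ^ n -
      n * (starRingEnd ℂ) (z i) * z j / ((sqNorm z + ε : ℝ) : ℂ) ^ (n + 1) := by
  rw [wirtingerBar, fderiv_bmKernel_single i j hz, fderiv_bmKernel_single i j hz]
  have hI := Complex.I_mul_I
  split_ifs <;> simp only [map_one, Complex.conj_I, mul_one] <;> ring_nf <;>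
    simp only [Complex.I_sq] <;> ring

/-- With q = |z|² + ε the two parts are n/q^n and n|z|²/q^{n+1}, which cancel up to ε. For ε > 0
this is an approximate multiple of δ_0; for ε = 0 it says that the kernel is divergence free off the
origin. -/
theorem sum_wirtingerBar_bmKernel {ε : ℝ} {z : Fin n → ℂ} (hz : sqNorm z + ε ≠ 0) :
    ∑ j, wirtingerBar j (bmKernel ε j) z = n * ε / ((sqNorm z + ε : ℝ) : ℂ) ^ (n + 1) := by
  have hne : ((sqNorm z + ε : ℝ) : ℂ) ≠ 0 := by exact_mod_cast hz
  have h1 : ∑ j, (starRingEnd ℂ) (z j) * z j = (sqNorm z : ℂ) := by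
    simp [sqNorm, Complex.conj_mul']
  simp only [wirtingerBar_bmKernel _ _ hz, if_true, Finset.sum_sub_distrib, mul_assoc,
    ← Finset.sum_div, ← Finset.mul_sum, h1]
  simp only [Finset.sum_const, Finset.card_univ, Fintype.card_fin, nsmul_eq_mul]
  rw [mul_one, pow_succ]
  field_simp
  push_cast
  ring

/-- Homogeneity of degree 1 − 2n, used below to compactify the domain of integration at infinity. -/
theorem bmKernel_smul (hn : 1 ≤ n) {t : ℝ} (ht : 0 < t) (j : Fin n) (z : Fin n → ℂ) :
    bmKernel 0 j z = (t : ℂ) ^ (2 * n - 1) * bmKernel 0 j (t • z) := by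
  have ht' : (t : ℂ) ≠ 0 := by exact_mod_cast ht.ne'
  have h2 : (t : ℂ) ^ (2 * n - 1) * t = (t ^ 2) ^ n := by
    rw [← pow_succ, ← pow_mul]; congr 1; omega
  simp only [bmKernel, add_zero, sqNorm_smul, Pi.smul_apply, Complex.real_smul, map_mul,
    Complex.conj_ofReal]
  push_cast
  rw [mul_pow, ← mul_div_assoc, ← mul_assoc, h2, mul_div_mul_left _ _ (by positivity)]

theorem bmKernel_neg (ε : ℝ) (j : Fin n) (z : Fin n → ℂ) :
    bmKernel ε j (-z) = -bmKernel ε j z := by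
  simp [bmKernel, sqNorm, neg_div]

theorem norm_bmKernel_le {ε : ℝ} (hε : 0 ≤ ε) (j : Fin n) {z : Fin n → ℂ} (hz : z ≠ 0) :
    ‖bmKernel ε j z‖ ≤ ‖z‖ / (‖z‖ ^ 2) ^ n := by
  have h0 := norm_pos_iff.2 hz
  rw [bmKernel, norm_div, norm_pow, Complex.norm_real, RCLike.norm_conj, Real.norm_of_nonneg
    (by have := sqNorm_nonneg z; positivity)]
  gcongr
  · exact norm_le_pi_norm z j
  · linarith [sq_norm_le_sqNorm z]

theorem measurable_bmKernel (ε : ℝ) (j : Fin n) : Measurable (bmKernel ε j) := by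
  unfold bmKernel sqNorm
  fun_prop

theorem finrank_real_fin_complex : Module.finrank ℝ (Fin n → ℂ) = 2 * n := by
  rw [Module.finrank_pi_fintype]; simp [Complex.finrank_real_complex, mul_comm]

/-- In polar coordinates for the sup norm the bound ‖z‖^{1−2n} exactly cancels the Jacobian factor
y^{2n−1}, leaving the constant 1 on (0, R]. -/
theorem integrableOn_bmKernel_closedBall {ε : ℝ} (hε : 0 ≤ ε) (hn : 1 ≤ n) (j : Fin n) (R : ℝ) :
    IntegrableOn (bmKernel ε j) (Metric.closedBall 0 R) := by
  have : Nonempty (Fin n) := ⟨j⟩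
  have h1 : Integrable (fun z : Fin n → ℂ =>
      (Iic R).indicator (fun y : ℝ => y / (y ^ 2) ^ n) ‖z‖) := by
    rw [integrable_fun_norm_addHaar volume, finrank_real_fin_complex]
    have h2 : IntegrableOn (fun _ : ℝ => (1 : ℝ)) (Ioc 0 R) := by simp
    rw [← integrable_indicator_iff measurableSet_Ioi]
    rw [← integrable_indicator_iff measurableSet_Ioc] at h2
    refine h2.congr (Eventually.of_forall fun y => ?_)
    by_cases hy : 0 < y
    · by_cases hR : y ≤ R
      · have e : y ^ (2 * n - 1) * y = (y ^ 2) ^ n := by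
          rw [← pow_succ, ← pow_mul]; congr 1; omega
        simp only [indicator, mem_Ioc, mem_Ioi, mem_Iic, hy, hR, and_self, if_true, smul_eq_mul]
        rw [← mul_div_assoc, e, div_self (by positivity)]
      · simp [indicator, hy, hR]
    · simp [indicator, hy]
  rw [← integrable_indicator_iff Metric.isClosed_closedBall.measurableSet]
  refine h1.mono' ((measurable_bmKernel ε j).indicator
    Metric.isClosed_closedBall.measurableSet).aestronglyMeasurable ?_
  have hne : ∀ᵐ z : Fin n → ℂ, z ≠ 0 := by simp [ae_iff]
  filter_upwards [hne] with z hz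
  by_cases hR : ‖z‖ ≤ R
  · simpa [indicator, hR] using norm_bmKernel_le hε j hz
  · simp [indicator, hR]

end Kernel

/-! ### The Cauchy-Pompeiu formula for the Bochner-Martinelli kernel -/

section CauchyPompeiu

variable {n : ℕ}

theorem continuous_sqNorm : Continuous (sqNorm (n := n)) := contDiff_sqNorm.continuous

theorem integral_exp_neg_mul_sqNorm {t : ℝ} (ht : 0 < t) :
    ∫ z : Fin n → ℂ, Real.exp (-t * sqNorm z) = (Real.pi / t) ^ n := by
  have h1 : (fun z : Fin n → ℂ => Real.exp (-t * sqNorm z)) =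
      fun z => ∏ k, Real.exp (-t * ‖z k‖ ^ (2 : ℝ)) := by
    funext z
    rw [← Real.exp_sum, sqNorm, Finset.mul_sum]
    simp
  rw [h1, integral_fintype_prod_volume_eq_pow (fun u : ℂ => Real.exp (-t * ‖u‖ ^ (2 : ℝ))),
    Complex.integral_exp_neg_mul_rpow one_le_two ht, Fintype.card_fin]
  congr 1
  norm_num [Real.Gamma_two, Real.rpow_neg_one, div_eq_mul_inv]

theorem integrable_inv_one_add_sqNorm_pow :
    Integrable fun z : Fin n → ℂ => ((1 + sqNorm z) ^ (n + 1))⁻¹ := by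
  have h1 := integrable_rpow_neg_one_add_norm_sq (E := Fin n → ℂ) (μ := volume)
    (r := 2 * (n + 1)) (by rw [finrank_real_fin_complex]; push_cast; linarith)
  refine h1.mono' ?_ (Eventually.of_forall fun z => ?_)
  · have : Measurable (sqNorm (n := n)) := continuous_sqNorm.measurable
    exact Measurable.aestronglyMeasurable (by fun_prop)
  · have h0 := sqNorm_nonneg z
    have h2 : -(2 * ((n : ℝ) + 1)) / 2 = -((n + 1 : ℕ) : ℝ) := by push_cast; ring
    rw [h2, Real.rpow_neg (by positivity), Real.rpow_natCast, Real.norm_of_nonneg (by positivity)]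
    gcongr
    exact sq_norm_le_sqNorm z

/-- Write n!/(1+|z|²)^{n+1} as ∫_0^∞ t^n e^{−(1+|z|²)t} dt and integrate over z first: the Gaussian
integral (π/t)^n cancels t^n, leaving π^n ∫ e^{−t} dt. -/
theorem integral_inv_one_add_sqNorm_pow :
    ∫ z : Fin n → ℂ, ((1 + sqNorm z) ^ (n + 1))⁻¹ = Real.pi ^ n / n.factorial := by
  set f : (Fin n → ℂ) → ℝ → ℝ := fun z t => t ^ n * Real.exp (-((1 + sqNorm z) * t)) with hf
  have hpos : ∀ z : Fin n → ℂ, 0 < 1 + sqNorm z := fun z => by have := sqNorm_nonneg z; positivity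
  have hint : ∀ z : Fin n → ℂ, ∫ t in Ioi 0, f z t = n.factorial * ((1 + sqNorm z) ^ (n + 1))⁻¹ := by
    intro z
    have h := Real.integral_rpow_mul_exp_neg_mul_Ioi (a := n + 1) (r := 1 + sqNorm z)
      (by positivity) (hpos z)
    simp only [add_sub_cancel_right, Real.rpow_natCast] at h
    rw [h, Real.Gamma_nat_eq_factorial, one_div, Real.inv_rpow (hpos z).le]
    norm_cast
    ring
  have hfi : ∀ z, IntegrableOn (f z) (Ioi 0) := fun z => by
    -- A non-integrable function has integral 0 by convention, but the value found in `hint` is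
    -- positive.
    by_contra hc
    have h := hint z
    rw [integral_undef hc] at h
    have h1 := hpos z
    have : (0 : ℝ) < n.factorial * ((1 + sqNorm z) ^ (n + 1))⁻¹ := by positivity
    linarith
  have hmeas : Continuous (Function.uncurry f) := by
    have := continuous_sqNorm (n := n)
    simp only [hf, Function.uncurry_def]
    fun_prop
  have hprod : Integrable (Function.uncurry f) (volume.prod (volume.restrict (Ioi 0))) := by
    rw [integrable_prod_iff hmeas.aestronglyMeasurable]
    refine ⟨Eventually.of_forall hfi, ?_⟩
    refine ((integrable_inv_one_add_sqNorm_pow (n := n)).const_mul (n.factorial : ℝ)).congr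
      (Eventually.of_forall fun z => ?_)
    simp only [Function.uncurry_apply_pair]
    rw [← hint z]
    refine setIntegral_congr_fun measurableSet_Ioi fun t ht => ?_
    have : (0 : ℝ) < t := ht
    exact (Real.norm_of_nonneg (by positivity)).symm
  have hswap := integral_integral_swap hprod
  simp only [hint, integral_const_mul] at hswap
  have h2 : ∀ t ∈ Ioi (0 : ℝ), ∫ z, f z t = Real.pi ^ n * Real.exp (-t) := by
    intro t ht
    have ht' : (0 : ℝ) < t := ht
    have h3 : (fun z : Fin n → ℂ => f z t) =
        fun z => t ^ n * Real.exp (-t) * Real.exp (-t * sqNorm z) := by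
      funext z
      rw [hf, mul_assoc, ← Real.exp_add]
      ring_nf
    rw [h3, integral_const_mul, integral_exp_neg_mul_sqNorm ht', div_pow]
    field_simp
  rw [setIntegral_congr_fun measurableSet_Ioi h2, integral_const_mul,
    integral_exp_neg_Ioi_zero, mul_one] at hswap
  rw [eq_div_iff (by positivity), mul_comm, hswap]

/-! ### Integration by parts against test functions and removal of the regularisation. -/

theorem continuous_wirtingerBar {f : (Fin n → ℂ) → ℂ} (hf : ContDiff ℝ ∞ f) (j : Fin n) :
    Continuous (wirtingerBar j f) := by
  have h1 : Continuous (fderiv ℝ f) := hf.continuous_fderiv (by simp)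
  unfold wirtingerBar
  fun_prop

theorem hasCompactSupport_wirtingerBar {f : (Fin n → ℂ) → ℂ} (hf : HasCompactSupport f)
    (j : Fin n) : HasCompactSupport (wirtingerBar j f) := by
  refine (hf.fderiv ℝ).mono' fun z hz => subset_tsupport _ ?_
  contrapose! hz
  simp only [Function.mem_support, ne_eq, not_not] at hz ⊢
  simp [wirtingerBar, hz]

theorem integral_mul_wirtingerBar {f φ : (Fin n → ℂ) → ℂ} (hf : ContDiff ℝ ∞ f)
    (hφ : ContDiff ℝ ∞ φ) (hc : HasCompactSupport φ) (j : Fin n) :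
    ∫ z, f z * wirtingerBar j φ z = -∫ z, wirtingerBar j f z * φ z := by
  have hf1 : Continuous (fderiv ℝ f) := hf.continuous_fderiv (by simp)
  have hφ1 : Continuous (fderiv ℝ φ) := hφ.continuous_fderiv (by simp)
  have hf0 := hf.continuous
  have hφ0 := hφ.continuous
  have hcd : ∀ v : Fin n → ℂ, HasCompactSupport fun z => fderiv ℝ φ z v := fun v =>
    (hc.fderiv ℝ).comp_left (g := fun L : (Fin n → ℂ) →L[ℝ] ℂ => L v) (by simp)
  have i1 : ∀ v, Integrable fun z => fderiv ℝ f z v * φ z := fun v =>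
    Continuous.integrable_of_hasCompactSupport (by fun_prop) (hc.mul_left)
  have i2 : ∀ v, Integrable fun z => f z * fderiv ℝ φ z v := fun v =>
    Continuous.integrable_of_hasCompactSupport (by fun_prop) ((hcd v).mul_left)
  have i3 : Integrable fun z => f z * φ z :=
    Continuous.integrable_of_hasCompactSupport (by fun_prop) (hc.mul_left)
  have key : ∀ v, ∫ z, f z * fderiv ℝ φ z v = -∫ z, fderiv ℝ f z v * φ z := fun v =>
    integral_mul_fderiv_eq_neg_fderiv_mul_of_integrable (i1 v) (i2 v) i3
      (fun z _ => (hf.differentiable (by simp)) z) (fun z _ => (hφ.differentiable (by simp)) z)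
  have e1 : ∀ z, f z * wirtingerBar j φ z = (1 / 2 : ℂ) * (f z * fderiv ℝ φ z (Pi.single j 1)) +
      (1 / 2 * Complex.I) * (f z * fderiv ℝ φ z (Pi.single j Complex.I)) := fun z => by
    rw [wirtingerBar]; ring
  have e2 : ∀ z, wirtingerBar j f z * φ z = (1 / 2 : ℂ) * (fderiv ℝ f z (Pi.single j 1) * φ z) +
      (1 / 2 * Complex.I) * (fderiv ℝ f z (Pi.single j Complex.I) * φ z) := fun z => by
    rw [wirtingerBar]; ring
  simp only [e1, e2]
  rw [integral_add ((i2 _).const_mul _) ((i2 _).const_mul _),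
    integral_add ((i1 _).const_mul _) ((i1 _).const_mul _)]
  simp only [integral_const_mul, key]
  ring

/-- Integrate by parts, insert the divergence of the regularised kernel, and substitute z = s y.
With ε = s² the powers of s cancel, so that s survives only in the argument of φ. -/
theorem integral_sum_bmKernel_mul_wirtingerBar_of_pos {s : ℝ} (hs : 0 < s)
    {φ : (Fin n → ℂ) → ℂ} (hφ : ContDiff ℝ ∞ φ) (hc : HasCompactSupport φ) :
    ∫ z, ∑ j, bmKernel (s ^ 2) j z * wirtingerBar j φ z =
      -∫ y, n * (((1 + sqNorm y) ^ (n + 1))⁻¹ : ℝ) * φ (s • y) := by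
  have hε : 0 < s ^ 2 := by positivity
  have hK := fun j => contDiff_bmKernel (n := n) hε j
  have i1 : ∀ j, Integrable fun z => bmKernel (s ^ 2) j z * wirtingerBar j φ z := fun j =>
    ((hK j).continuous.mul (continuous_wirtingerBar hφ j)).integrable_of_hasCompactSupport
      (hasCompactSupport_wirtingerBar hc j).mul_left
  have i2 : ∀ j, Integrable fun z => wirtingerBar j (bmKernel (s ^ 2) j) z * φ z := fun j =>
    ((continuous_wirtingerBar (hK j) j).mul hφ.continuous).integrable_of_hasCompactSupport
      hc.mul_left
  rw [integral_finsetSum _ fun j _ => i1 j]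
  simp only [integral_mul_wirtingerBar (hK _) hφ hc, Finset.sum_neg_distrib]
  rw [← integral_finsetSum _ fun j _ => i2 j]
  congr 1
  simp only [← Finset.sum_mul]
  set g : (Fin n → ℂ) → ℂ := fun z => (∑ j, wirtingerBar j (bmKernel (s ^ 2) j) z) * φ z with hg
  have h1 := Measure.integral_comp_smul (volume : Measure (Fin n → ℂ)) g s
  rw [finrank_real_fin_complex, abs_of_pos (by positivity)] at h1
  have h2 : ∫ z, g z = (s ^ (2 * n) : ℝ) • ∫ y, g (s • y) := by
    rw [h1, smul_smul, mul_inv_cancel₀ (by positivity), one_smul]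
  rw [h2, ← integral_smul]
  refine integral_congr_ae (Eventually.of_forall fun y => ?_)
  have h0 := sqNorm_nonneg y
  have h3 : sqNorm (s • y) + s ^ 2 ≠ 0 := by rw [sqNorm_smul]; positivity
  have h4 : (1 + (sqNorm y : ℂ)) ≠ 0 := by
    have : (1 + sqNorm y : ℝ) ≠ 0 := by positivity
    exact_mod_cast this
  have h5 : (s : ℂ) ≠ 0 := by exact_mod_cast hs.ne'
  simp only [hg, sum_wirtingerBar_bmKernel h3, Complex.real_smul, sqNorm_smul]
  push_cast
  have h6 : (s : ℂ) ^ 2 * sqNorm y + s ^ 2 = s ^ 2 * (1 + sqNorm y) := by ring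
  rw [h6, mul_pow, ← pow_mul]
  have h7 : (s : ℂ) ^ (2 * (n + 1)) = s ^ (2 * n) * s ^ 2 := by ring
  rw [h7]
  field_simp

theorem tendsto_bmKernel (j : Fin n) {z : Fin n → ℂ} (hz : z ≠ 0) :
    Tendsto (fun s : ℝ => bmKernel (s ^ 2) j z) (𝓝[>] 0) (𝓝 (bmKernel 0 j z)) := by
  have h1 : ContinuousAt (fun s : ℝ => bmKernel (s ^ 2) j z) 0 := by
    unfold bmKernel
    refine ContinuousAt.div continuousAt_const (by fun_prop) (pow_ne_zero _ ?_)
    have := (sqNorm_pos hz).ne'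
    simpa using this
  have h2 : bmKernel ((0 : ℝ) ^ 2) j z = bmKernel 0 j z := by norm_num
  simpa only [h2] using h1.tendsto.mono_left nhdsWithin_le_nhds

theorem norm_bmKernel_le_zero {ε : ℝ} (hε : 0 ≤ ε) (j : Fin n) {z : Fin n → ℂ} (hz : z ≠ 0) :
    ‖bmKernel ε j z‖ ≤ ‖bmKernel 0 j z‖ := by
  have h0 := sqNorm_pos hz
  simp only [bmKernel, norm_div, norm_pow, Complex.norm_real, add_zero]
  rw [Real.norm_of_nonneg h0.le, Real.norm_of_nonneg (by positivity)]
  gcongr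
  linarith

theorem integrable_bmKernel_mul (hn : 1 ≤ n) (j : Fin n) {φ : (Fin n → ℂ) → ℂ}
    (hφ : Continuous φ) (hc : HasCompactSupport φ) : Integrable fun z => bmKernel 0 j z * φ z := by
  obtain ⟨R, hR⟩ := hc.isCompact.isBounded.subset_closedBall 0
  have h1 := (integrable_indicator_iff Metric.isClosed_closedBall.measurableSet).2
    (integrableOn_bmKernel_closedBall le_rfl hn j R)
  obtain ⟨C, hC⟩ := hφ.bounded_above_of_compact_support hc
  refine (h1.mul_bdd hφ.aestronglyMeasurable (Eventually.of_forall hC)).congr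
    (Eventually.of_forall fun z => ?_)
  by_cases hz : z ∈ Metric.closedBall 0 R
  · simp [indicator_of_mem hz]
  · have : φ z = 0 := by
      by_contra h
      exact hz (hR (subset_tsupport _ h))
    simp [this]

theorem ae_ne_zero_fin_complex (hn : 1 ≤ n) : ∀ᵐ z : Fin n → ℂ, z ≠ 0 := by
  have : Nonempty (Fin n) := ⟨⟨0, hn⟩⟩
  simp [ae_iff]

/-- The limit s → 0+ of the regularised identity, dominated on the left by the locally integrable
kernel with ε = 0 and on the right by sup |φ| times an integrable function. The constant is n ·
π^n/n!, and the sign comes from integrating by parts. -/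
theorem integral_sum_bmKernel_mul_wirtingerBar (hn : 1 ≤ n)
    {φ : (Fin n → ℂ) → ℂ} (hφ : ContDiff ℝ ∞ φ) (hc : HasCompactSupport φ) :
    ∫ z, ∑ j, bmKernel 0 j z * wirtingerBar j φ z =
      -((Real.pi ^ n / (n - 1).factorial : ℝ) : ℂ) * φ 0 := by
  have hL : Tendsto (fun s : ℝ => ∫ z, ∑ j, bmKernel (s ^ 2) j z * wirtingerBar j φ z) (𝓝[>] 0)
      (𝓝 (∫ z, ∑ j, bmKernel 0 j z * wirtingerBar j φ z)) := by
    refine tendsto_integral_filter_of_dominated_convergence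
      (fun z => ∑ j, ‖bmKernel 0 j z * wirtingerBar j φ z‖) ?_ ?_ ?_ ?_
    · refine Eventually.of_forall fun s => Measurable.aestronglyMeasurable ?_
      exact Finset.measurable_fun_sum _ fun j _ => (measurable_bmKernel _ j).mul
        (continuous_wirtingerBar hφ j).measurable
    · refine Eventually.of_forall fun s => ?_
      filter_upwards [ae_ne_zero_fin_complex hn] with z hz
      refine (norm_sum_le _ _).trans (Finset.sum_le_sum fun j _ => ?_)
      rw [norm_mul, norm_mul]
      gcongr
      exact norm_bmKernel_le_zero (by positivity) j hz
    · exact integrable_finsetSum _ fun j _ => (integrable_bmKernel_mul hn j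
        (continuous_wirtingerBar hφ j) (hasCompactSupport_wirtingerBar hc j)).norm
    · filter_upwards [ae_ne_zero_fin_complex hn] with z hz
      exact tendsto_finsetSum _ fun j _ => (tendsto_bmKernel j hz).mul_const _
  have hi := (integrable_inv_one_add_sqNorm_pow (n := n)).ofReal (𝕜 := ℂ)
  have hR : Tendsto (fun s : ℝ => -∫ y : Fin n → ℂ,
      n * (((1 + sqNorm y) ^ (n + 1))⁻¹ : ℝ) * φ (s • y)) (𝓝[>] 0)
      (𝓝 (-∫ y : Fin n → ℂ, n * (((1 + sqNorm y) ^ (n + 1))⁻¹ : ℝ) * φ 0)) := by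
    obtain ⟨C, hC⟩ := hφ.continuous.bounded_above_of_compact_support hc
    have hq := (continuous_sqNorm (n := n)).measurable
    have hφm := hφ.continuous
    refine (tendsto_integral_filter_of_dominated_convergence
      (fun y : Fin n → ℂ => ‖(n : ℂ) * (((1 + sqNorm y) ^ (n + 1))⁻¹ : ℝ)‖ * C)
      ?_ ?_ ?_ ?_).neg
    · refine Eventually.of_forall fun s => ?_
      exact (hi.const_mul (n : ℂ)).aestronglyMeasurable.mul
        (by fun_prop : Continuous fun y : Fin n → ℂ => φ (s • y)).aestronglyMeasurable
    · refine Eventually.of_forall fun s => Eventually.of_forall fun y => ?_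
      rw [norm_mul]
      gcongr
      exact hC _
    · exact (hi.const_mul (n : ℂ)).norm.mul_const C
    · refine Eventually.of_forall fun y => Tendsto.const_mul _ ?_
      have h1 : ContinuousAt (fun s : ℝ => φ (s • y)) 0 := by fun_prop
      simpa using h1.tendsto.mono_left nhdsWithin_le_nhds
  have hE := hL.congr' (f₂ := fun s : ℝ => -∫ y : Fin n → ℂ,
      n * (((1 + sqNorm y) ^ (n + 1))⁻¹ : ℝ) * φ (s • y)) (by
    filter_upwards [self_mem_nhdsWithin] with s hs
    exact integral_sum_bmKernel_mul_wirtingerBar_of_pos hs hφ hc)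
  rw [tendsto_nhds_unique hE hR, integral_mul_const, integral_const_mul, integral_complex_ofReal,
    integral_inv_one_add_sqNorm_pow]
  have hf : (n.factorial : ℂ) = n * (n - 1).factorial := by
    exact_mod_cast (Nat.mul_factorial_pred (by omega)).symm
  have hn0 : (n : ℂ) ≠ 0 := by exact_mod_cast (by omega : n ≠ 0)
  have hn1 : ((n - 1).factorial : ℂ) ≠ 0 := by exact_mod_cast (n - 1).factorial_ne_zero
  push_cast
  rw [hf]
  field_simp

theorem fderiv_comp_const_sub {φ : (Fin n → ℂ) → ℂ} {y z : Fin n → ℂ}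
    (hφ : DifferentiableAt ℝ φ (y - z)) :
    fderiv ℝ (fun w => φ (y - w)) z = -fderiv ℝ φ (y - z) := by
  have h : HasFDerivAt (fun w => φ (y - w)) _ z :=
    hφ.hasFDerivAt.comp z ((hasFDerivAt_id z).const_sub y)
  rw [h.fderiv]
  ext v
  simp

theorem wirtingerBar_comp_const_sub {φ : (Fin n → ℂ) → ℂ} (j : Fin n) {y z : Fin n → ℂ}
    (hφ : DifferentiableAt ℝ φ (y - z)) :
    wirtingerBar j (fun w => φ (y - w)) z = -wirtingerBar j φ (y - z) := by
  simp only [wirtingerBar, fderiv_comp_const_sub hφ, _root_.neg_apply]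
  ring

/-- The Cauchy-Pompeiu formula for compactly supported functions. -/
theorem integral_sum_bmKernel_mul_wirtingerBar_sub (hn : 1 ≤ n)
    {φ : (Fin n → ℂ) → ℂ} (hφ : ContDiff ℝ ∞ φ) (hc : HasCompactSupport φ) (y : Fin n → ℂ) :
    ∫ z, ∑ j, bmKernel 0 j z * wirtingerBar j φ (y - z) =
      ((Real.pi ^ n / (n - 1).factorial : ℝ) : ℂ) * φ y := by
  -- The reflected function w ↦ φ(y − w) moves the evaluation point from 0 to y and absorbs the
  -- sign.
  have h := integral_sum_bmKernel_mul_wirtingerBar hn (φ := fun w => φ (y - w))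
    (hφ.comp (contDiff_const.sub contDiff_id)) (hc.comp_homeomorph (Homeomorph.subLeft y))
  simp only [wirtingerBar_comp_const_sub _ ((hφ.differentiable (by simp)) _), mul_neg, Finset.sum_neg_distrib, integral_neg,
    sub_zero, neg_mul, neg_inj] at h
  exact h

end CauchyPompeiu

/-! ### Smoothness of the integrals of products of kernels -/

section KernelIntegral

variable {n : ℕ}

/-- `∏_a K_{i_a}(x_a - z)`. -/
noncomputable def kernelProd (i : Fin 3 → Fin n) (x : Fin 3 → Fin n → ℂ) (z : Fin n → ℂ) : ℂ :=
  ∏ a, bmKernel 0 (i a) (x a - z)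

/-- `∫ ∏_a K_{i_a}(x_a - z) dz`. -/
noncomputable def kernelIntegral (i : Fin 3 → Fin n) (x : Fin 3 → Fin n → ℂ) : ℂ :=
  ∫ z, kernelProd i x z

theorem contDiffAt_bmKernel_comp {E : Type} [NormedAddCommGroup E] [NormedSpace ℝ E]
    {f : E → Fin n → ℂ} {p : E} (j : Fin n) (hf : ContDiffAt ℝ ∞ f p) (hp : f p ≠ 0) :
    ContDiffAt ℝ ∞ (fun q => bmKernel 0 j (f q)) p :=
  (contDiffAt_bmKernel_zero j hp).comp p hf

theorem isOpen_conf (m n : ℕ) : IsOpen (Conf m n) := by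
  have : Conf m n = ⋂ a : Fin m, ⋂ b : Fin m, {x | a ≠ b → x a ≠ x b} := by
    ext x; simp [Conf]
  rw [this]
  refine isOpen_iInter_of_finite fun a => isOpen_iInter_of_finite fun b => ?_
  by_cases h : a = b
  · simp [h]
  · simpa [h] using isOpen_ne_fun (continuous_apply a) (continuous_apply b)

/-- The factor 8 leaves room for everything below: cutoffs supported in radius 3r, points moving by
less than r, and shifted integration variables of norm below 5r. -/
theorem exists_separation {m : ℕ} {x : Fin m → Fin n → ℂ} (hx : x ∈ Conf m n) :
    ∃ r > 0, ∀ a b, a ≠ b → 8 * r ≤ ‖x a - x b‖ := by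
  have h1 : ∀ p : Fin m × Fin m, ∃ r > 0, p.1 ≠ p.2 → 8 * r ≤ ‖x p.1 - x p.2‖ := fun p => by
    by_cases h : p.1 = p.2
    · exact ⟨1, one_pos, fun h' => absurd h h'⟩
    · exact ⟨‖x p.1 - x p.2‖ / 8, by
        have := norm_pos_iff.2 (sub_ne_zero.2 (hx _ _ h)); positivity, fun _ => by linarith⟩
  choose r hr hxr using h1
  obtain ⟨s, hs, hs'⟩ : ∃ s > 0, ∀ p, s ≤ r p := by
    obtain ⟨s, hs⟩ := (Set.finite_range r).bddBelow
    by_cases hm : Nonempty (Fin m × Fin m)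
    · obtain ⟨p, hp⟩ := Finite.exists_min r
      exact ⟨r p, hr p, hp⟩
    · exact ⟨1, one_pos, fun p => absurd ⟨p⟩ hm⟩
  exact ⟨s, hs, fun a b hab => by linarith [hxr (a, b) hab, hs' (a, b)]⟩

/-- `(1 + |z|)⁻¹`. -/
noncomputable def invNorm (z : Fin n → ℂ) : ℝ := (1 + ‖z‖)⁻¹

theorem invNorm_pos (z : Fin n → ℂ) : 0 < invNorm z := by unfold invNorm; positivity

theorem continuous_invNorm : Continuous (invNorm (n := n)) := by
  unfold invNorm
  exact Continuous.inv₀ (by fun_prop) fun z => by positivity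

theorem integrable_invNorm_pow {k : ℕ} (hk : 2 * n < k) :
    Integrable fun z : Fin n → ℂ => invNorm z ^ k := by
  have h := integrable_one_add_norm (E := Fin n → ℂ) (μ := volume) (r := k)
    (by rw [finrank_real_fin_complex]; exact_mod_cast hk)
  refine h.congr (Eventually.of_forall fun z => ?_)
  simp only [invNorm]
  rw [Real.rpow_neg (by positivity), Real.rpow_natCast, inv_pow]

/-- Homogeneity with t = λ = (1+|z|)⁻¹. The decay at infinity splits off, and the remaining factor
depends on z only through the bounded pair (λ, λz), for which λ = 0 represents infinity. -/
theorem bmKernel_sub_eq (hn : 1 ≤ n) (j : Fin n) (y z : Fin n → ℂ) :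
    bmKernel 0 j (y - z) =
      (invNorm z : ℂ) ^ (2 * n - 1) * bmKernel 0 j (invNorm z • y - invNorm z • z) := by
  rw [bmKernel_smul hn (invNorm_pos z), smul_sub]

/-- Pairs `(λ, y)` with `λ + |y| = 1` and `|y - λ c| ≥ δ λ` for all centres `c = c_a`. -/
def farSet {ι : Type} (c : ι → Fin n → ℂ) (δ : ℝ) : Set (ℝ × (Fin n → ℂ)) :=
  {p | 0 ≤ p.1 ∧ p.1 + ‖p.2‖ = 1 ∧ ∀ a, δ * p.1 ≤ ‖p.2 - p.1 • c a‖}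

theorem isCompact_farSet {ι : Type} (c : ι → Fin n → ℂ) (δ : ℝ) : IsCompact (farSet c δ) := by
  refine Metric.isCompact_of_isClosed_isBounded ?_ ?_
  · have : farSet c δ = {p | 0 ≤ p.1} ∩ ({p | p.1 + ‖p.2‖ = 1} ∩
        ⋂ a, {p | δ * p.1 ≤ ‖p.2 - p.1 • c a‖}) := by
      ext p; simp [farSet]
    rw [this]
    refine (isClosed_le (by fun_prop) (by fun_prop)).inter
      ((isClosed_eq (by fun_prop) (by fun_prop)).inter (isClosed_iInter fun a => ?_))
    exact isClosed_le (by fun_prop) (by fun_prop)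
  · refine (Metric.isBounded_closedBall (x := 0) (r := 1)).subset fun p hp => ?_
    rw [mem_closedBall_zero_iff, Prod.norm_def]
    have := norm_nonneg p.2
    refine max_le ?_ (by linarith [hp.1, hp.2.1])
    rw [Real.norm_of_nonneg hp.1]
    linarith [hp.2.1]

theorem mem_farSet {ι : Type} {c : ι → Fin n → ℂ} {δ : ℝ} {z : Fin n → ℂ}
    (hz : ∀ a, δ ≤ ‖z - c a‖) : (invNorm z, invNorm z • z) ∈ farSet c δ := by
  have h0 := invNorm_pos z
  refine ⟨h0.le, ?_, fun a => ?_⟩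
  · simp only [norm_smul, Real.norm_of_nonneg h0.le]
    rw [← mul_one_add, invNorm, inv_mul_cancel₀ (by positivity)]
  · simp only [← smul_sub, norm_smul, Real.norm_of_nonneg h0.le]
    rw [mul_comm]
    exact mul_le_mul_of_nonneg_left (hz a) h0.le

/-- If λ = 0 the second component has norm 1, hence is nonzero. If λ > 0, dividing by λ gives a
point at distance at least δ from the centre, whereas y is closer. -/
theorem smul_sub_ne_zero_of_mem_farSet {ι : Type} {c : ι → Fin n → ℂ} {δ : ℝ}
    {p : ℝ × (Fin n → ℂ)} (hp : p ∈ farSet c δ) {a : ι} {y : Fin n → ℂ} (hy : ‖y - c a‖ < δ) :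
    p.1 • y - p.2 ≠ 0 := by
  intro h
  have h1 : p.2 = p.1 • y := (sub_eq_zero.1 h).symm
  rcases hp.1.eq_or_lt with h0 | h0
  · have h2 := hp.2.1
    rw [h1, ← h0] at h2
    simp at h2
  · have h2 := hp.2.2 a
    rw [h1, ← smul_sub, norm_smul, Real.norm_of_nonneg h0.le, mul_comm] at h2
    linarith [le_of_mul_le_mul_left h2 h0]

/-- A smooth cutoff around `c`, equal to `1` on the ball of radius `2r` and supported in the ball
of radius `3r`. -/
noncomputable def cutoff (c : Fin n → ℂ) {r : ℝ} (hr : 0 < r) : ContDiffBump c :=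
  ⟨2 * r, 3 * r, by linarith, by linarith⟩

theorem cutoff_eq_one {c : Fin n → ℂ} {r : ℝ} (hr : 0 < r) {z : Fin n → ℂ}
    (hz : ‖z - c‖ ≤ 2 * r) : cutoff c hr z = 1 :=
  (cutoff c hr).one_of_mem_closedBall (by rw [mem_closedBall_iff_norm]; exact hz)

theorem cutoff_eq_zero {c : Fin n → ℂ} {r : ℝ} (hr : 0 < r) {z : Fin n → ℂ}
    (hz : 3 * r ≤ ‖z - c‖) : cutoff c hr z = 0 :=
  (cutoff c hr).zero_of_le_dist (by rw [dist_eq_norm]; exact hz)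

variable {r : ℝ} {x₀ : Fin 3 → Fin n → ℂ}

theorem cutoff_sum_eq_one (hr : 0 < r) (hx₀ : ∀ a b, a ≠ b → 8 * r ≤ ‖x₀ a - x₀ b‖)
    {z : Fin n → ℂ} {a : Fin 3} (hz : ‖z - x₀ a‖ < 2 * r) :
    ∑ b, cutoff (x₀ b) hr z = 1 := by
  rw [Finset.sum_eq_single a, cutoff_eq_one hr hz.le]
  · intro b _ hb
    refine cutoff_eq_zero hr ?_
    have h1 := norm_sub_le_norm_sub_add_norm_sub (x₀ a) z (x₀ b)
    rw [norm_sub_rev (x₀ a) z] at h1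
    linarith [hx₀ a b hb.symm]
  · simp

theorem measurable_invNorm_pair :
    Measurable fun z : Fin n → ℂ => (invNorm z, invNorm z • z) := by
  have := continuous_invNorm (n := n)
  exact (Continuous.prodMk this (this.smul continuous_id)).measurable

/-- In the variables (λ, λz) the integrand is a weight times a function smooth in x and in a point
of the compact `farSet`. The weight includes the decay of all three kernels. -/
theorem kernel_far_piece (hn : 1 ≤ n) (hr : 0 < r)
    (hx₀ : ∀ a b, a ≠ b → 8 * r ≤ ‖x₀ a - x₀ b‖) (i : Fin 3 → Fin n) :
    ContDiffOn ℝ ∞ (fun x => ∫ z, (1 - ∑ b, (cutoff (x₀ b) hr z : ℂ)) * kernelProd i x z)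
        (Metric.ball x₀ r) ∧
      ∀ x ∈ Metric.ball x₀ r,
        Integrable fun z => (1 - ∑ b, (cutoff (x₀ b) hr z : ℂ)) * kernelProd i x z := by
  set w : (Fin n → ℂ) → ℂ := fun z =>
    (1 - ∑ b, (cutoff (x₀ b) hr z : ℂ)) * (invNorm z ^ (3 * (2 * n - 1)) : ℝ) with hw
  set h : (Fin 3 → Fin n → ℂ) × (ℝ × (Fin n → ℂ)) → ℂ := fun p =>
    ∏ a, bmKernel 0 (i a) (p.2.1 • p.1 a - p.2.2) with hh
  set O : Set ((Fin 3 → Fin n → ℂ) × (ℝ × (Fin n → ℂ))) :=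
    {p | ∀ a, p.2.1 • p.1 a - p.2.2 ≠ 0} with hO
  have hOo : IsOpen O := by
    have : O = ⋂ a, {p | p.2.1 • p.1 a - p.2.2 ≠ 0} := by ext p; simp [hO]
    rw [this]
    exact isOpen_iInter_of_finite fun a => isOpen_ne_fun (by fun_prop) (by fun_prop)
  have hhO : ContDiffOn ℝ ∞ h O := fun p hp => by
    refine ContDiffAt.contDiffWithinAt (contDiffAt_prod fun a _ => ?_)
    exact contDiffAt_bmKernel_comp (i a) (by fun_prop) (hp a)
  have hwi : Integrable w := by
    have h1 := (integrable_invNorm_pow (n := n) (k := 3 * (2 * n - 1)) (by omega)).ofReal (𝕜 := ℂ)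
    -- The decay exponent 3(2n−1) exceeds the real dimension 2n because n ≥ 1; the bound 4 is 1 plus
    -- one for each of the three cutoffs.
    refine Integrable.bdd_mul (c := 4) h1 ?_ (Eventually.of_forall fun z => ?_)
    · refine Continuous.aestronglyMeasurable ?_
      exact continuous_const.sub (continuous_finsetSum _ fun b _ =>
        Complex.continuous_ofReal.comp (cutoff (x₀ b) hr).continuous)
    · refine (norm_sub_le _ _).trans ?_
      have h2 : ‖∑ b, (cutoff (x₀ b) hr z : ℂ)‖ ≤ ∑ _b : Fin 3, (1 : ℝ) := by
        refine (norm_sum_le _ _).trans (Finset.sum_le_sum fun b _ => ?_)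
        rw [Complex.norm_real, Real.norm_of_nonneg (cutoff (x₀ b) hr).nonneg]
        exact (cutoff (x₀ b) hr).le_one
      simp at h2 ⊢
      linarith
  have hwK : ∀ z, w z ≠ 0 → (invNorm z, invNorm z • z) ∈ farSet x₀ (2 * r) := fun z hz => by
    refine mem_farSet fun a => ?_
    by_contra hlt
    refine hz ?_
    have := cutoff_sum_eq_one hr hx₀ (not_le.1 hlt)
    simp only [hw]
    rw [← Complex.ofReal_sum, this]
    simp
  have hUO : Metric.ball x₀ r ×ˢ farSet x₀ (2 * r) ⊆ O := fun p hp a => by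
    refine smul_sub_ne_zero_of_mem_farSet hp.2 (a := a) ?_
    have h1 : ‖p.1 - x₀‖ < r := by simpa [dist_eq_norm] using hp.1
    have h2 := norm_le_pi_norm (p.1 - x₀) a
    simp only [Pi.sub_apply] at h2
    linarith
  have heq : ∀ x z, (1 - ∑ b, (cutoff (x₀ b) hr z : ℂ)) * kernelProd i x z =
      w z • h (x, (invNorm z, invNorm z • z)) := fun x z => by
    simp only [hw, hh, kernelProd, bmKernel_sub_eq hn _ _ z, Finset.prod_mul_distrib,
      Finset.prod_const, smul_eq_mul]
    rw [Finset.card_univ, Fintype.card_fin, ← pow_mul]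
    push_cast
    ring
  simp only [heq]
  refine ⟨contDiffOn_integral_smul_comp hwi measurable_invNorm_pair (isCompact_farSet _ _) hwK
    Metric.isOpen_ball hOo hUO hhO, fun x hx => ?_⟩
  refine integrable_smul_comp hwi measurable_invNorm_pair (isCompact_farSet _ _) hwK
    (f := fun p => h (x, p)) ?_
  exact hhO.continuousOn.comp (by fun_prop) fun p hp => hUO ⟨hx, hp⟩

/-- Substituting z ↦ x_a − z fixes the singularity at the origin, so the singular kernel becomes an
x-independent weight, while the cutoff and the other kernels become smooth in (x, z). The radius 4r
covers the support radius 3r plus the displacement of x_a. -/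
theorem kernel_near_piece (hn : 1 ≤ n) (hr : 0 < r)
    (hx₀ : ∀ a b, a ≠ b → 8 * r ≤ ‖x₀ a - x₀ b‖) (i : Fin 3 → Fin n) (a : Fin 3) :
    ContDiffOn ℝ ∞ (fun x => ∫ z, (cutoff (x₀ a) hr z : ℂ) * kernelProd i x z)
        (Metric.ball x₀ r) ∧
      ∀ x ∈ Metric.ball x₀ r, Integrable fun z => (cutoff (x₀ a) hr z : ℂ) * kernelProd i x z := by
  set w : (Fin n → ℂ) → ℂ := (Metric.closedBall 0 (4 * r)).indicator (bmKernel 0 (i a)) with hw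
  set h : (Fin 3 → Fin n → ℂ) × (Fin n → ℂ) → ℂ := fun p =>
    (cutoff (x₀ a) hr (p.1 a - p.2) : ℂ) *
      ∏ b ∈ Finset.univ.erase a, bmKernel 0 (i b) (p.1 b - p.1 a + p.2) with hh
  have hx : ∀ x ∈ Metric.ball x₀ r, ∀ b, ‖x b - x₀ b‖ < r := fun x hx b => by
    have h1 : ‖x - x₀‖ < r := by simpa [dist_eq_norm] using hx
    exact (norm_le_pi_norm (x - x₀) b).trans_lt h1
  have hhO : ContDiffOn ℝ ∞ h (Metric.ball x₀ r ×ˢ Metric.ball 0 (5 * r)) := fun p hp => by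
    refine ContDiffAt.contDiffWithinAt (ContDiffAt.mul ?_ (contDiffAt_prod fun b hb => ?_))
    · refine ContDiff.contDiffAt ?_
      exact Complex.ofRealCLM.contDiff.comp ((cutoff (x₀ a) hr).contDiff.comp (by fun_prop))
    · refine contDiffAt_bmKernel_comp (i b) (by fun_prop) fun h0 => ?_
      have h1 := hx _ hp.1 a
      have h2 := hx _ hp.1 b
      have h3 : ‖p.2‖ < 5 * r := by simpa using hp.2
      have h4 := hx₀ b a (Finset.ne_of_mem_erase hb)
      have h5 : x₀ b - x₀ a = (p.1 a - x₀ a) - (p.1 b - x₀ b) - p.2 := by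
        linear_combination h0
      rw [h5] at h4
      have h6 := norm_sub_le ((p.1 a - x₀ a) - (p.1 b - x₀ b)) p.2
      have h7 := norm_sub_le (p.1 a - x₀ a) (p.1 b - x₀ b)
      linarith
  have hwi : Integrable w := (integrable_indicator_iff Metric.isClosed_closedBall.measurableSet).2
    (integrableOn_bmKernel_closedBall le_rfl hn (i a) _)
  have hwK : ∀ z, w z ≠ 0 → id z ∈ Metric.closedBall (0 : Fin n → ℂ) (4 * r) := fun z hz =>
    Set.mem_of_indicator_ne_zero hz
  have hOo : IsOpen (Metric.ball x₀ r ×ˢ Metric.ball (0 : Fin n → ℂ) (5 * r)) :=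
    Metric.isOpen_ball.prod Metric.isOpen_ball
  have hUO : Metric.ball x₀ r ×ˢ Metric.closedBall (0 : Fin n → ℂ) (4 * r) ⊆
      Metric.ball x₀ r ×ˢ Metric.ball 0 (5 * r) :=
    prod_mono subset_rfl (Metric.closedBall_subset_ball (by linarith))
  have heq : ∀ x ∈ Metric.ball x₀ r, ∀ z, (cutoff (x₀ a) hr z : ℂ) * kernelProd i x z =
      w (x a - z) • h (x, id (x a - z)) := fun x hxr z => by
    by_cases hz : ‖x a - z‖ ≤ 4 * r
    · simp only [hw, hh, kernelProd, id]
      rw [indicator_of_mem (by simpa using hz), smul_eq_mul, sub_sub_cancel,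
        ← Finset.mul_prod_erase _ _ (Finset.mem_univ a)]
      simp only [sub_add_sub_cancel]
      ring
    · have h1 : cutoff (x₀ a) hr z = 0 := by
        refine cutoff_eq_zero hr ?_
        have h2 := norm_sub_le_norm_sub_add_norm_sub (x a) (x₀ a) z
        rw [norm_sub_rev (x₀ a) z] at h2
        linarith [hx x hxr a]
      rw [h1, hw, indicator_of_notMem (by simpa using hz)]
      simp
  have hint : ∀ x ∈ Metric.ball x₀ r, Integrable fun z => w z • h (x, id z) := fun x hxr =>
    integrable_smul_comp hwi measurable_id (isCompact_closedBall _ _) hwK (f := fun p => h (x, p))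
      (hhO.continuousOn.comp (by fun_prop) fun p hp => hUO ⟨hxr, hp⟩)
  refine ⟨(contDiffOn_integral_smul_comp hwi measurable_id (isCompact_closedBall _ _) hwK
    Metric.isOpen_ball hOo hUO hhO).congr fun x hxr => ?_, fun x hxr => ?_⟩
  · simp only [heq x hxr]
    exact integral_sub_left_eq_self (fun z => w z • h (x, id z)) volume (x a)
  · simp only [heq x hxr]
    exact (hint x hxr).comp_sub_left (x a)

theorem kernelProd_eq_pieces (hr : 0 < r) (i : Fin 3 → Fin n) (x : Fin 3 → Fin n → ℂ)
    (z : Fin n → ℂ) : kernelProd i x z =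
      (1 - ∑ b, (cutoff (x₀ b) hr z : ℂ)) * kernelProd i x z +
        ∑ b, (cutoff (x₀ b) hr z : ℂ) * kernelProd i x z := by
  rw [← Finset.sum_mul]; ring

theorem integrable_kernelProd (hn : 1 ≤ n) (i : Fin 3 → Fin n) {x : Fin 3 → Fin n → ℂ}
    (hx : x ∈ Conf 3 n) : Integrable (kernelProd i x) := by
  obtain ⟨r, hr, hsep⟩ := exists_separation hx
  have h0 := (kernel_far_piece hn hr hsep i).2 x (Metric.mem_ball_self hr)
  have h1 := fun a => (kernel_near_piece hn hr hsep i a).2 x (Metric.mem_ball_self hr)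
  refine (h0.add (integrable_finsetSum Finset.univ fun a _ => h1 a)).congr
    (Eventually.of_forall fun z => ?_)
  simpa using (kernelProd_eq_pieces hr i x z).symm

theorem contDiffOn_kernelIntegral (hn : 1 ≤ n) (i : Fin 3 → Fin n) :
    ContDiffOn ℝ ∞ (kernelIntegral i) (Conf 3 n) := by
  intro x₀ hx₀
  obtain ⟨r, hr, hsep⟩ := exists_separation hx₀
  have h0 := kernel_far_piece hn hr hsep i
  have h1 := fun a => kernel_near_piece hn hr hsep i a
  refine ContDiffAt.contDiffWithinAt (ContDiffOn.contDiffAt ?_ (Metric.ball_mem_nhds x₀ hr))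
  refine (h0.1.add (ContDiffOn.sum (s := Finset.univ) fun a _ => (h1 a).1)).congr fun x hx => ?_
  rw [kernelIntegral, ← integral_finsetSum _ fun a _ => (h1 a).2 x hx,
    ← integral_add (h0.2 x hx) (integrable_finsetSum _ fun a _ => (h1 a).2 x hx)]
  exact integral_congr_ae (Eventually.of_forall fun z => kernelProd_eq_pieces hr i x z)

end KernelIntegral

/-! ### First derivatives of the integrals of products of kernels -/

section KernelDerivative

variable {n : ℕ}

theorem wirtingerBar_congr {f g : (Fin n → ℂ) → ℂ} (j : Fin n) {y : Fin n → ℂ} (h : f =ᶠ[𝓝 y] g) :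
    wirtingerBar j f y = wirtingerBar j g y := by
  rw [wirtingerBar, wirtingerBar, h.fderiv_eq]

theorem wirtingerBar_const_mul (j : Fin n) {f : (Fin n → ℂ) → ℂ} {y : Fin n → ℂ}
    (hf : DifferentiableAt ℝ f y) (c : ℂ) :
    wirtingerBar j (fun y => c * f y) y = c * wirtingerBar j f y := by
  simp only [wirtingerBar]
  rw [fderiv_const_mul hf]
  simp only [_root_.smul_apply, smul_eq_mul]
  ring

theorem wirtingerBar_add (j : Fin n) {f g : (Fin n → ℂ) → ℂ} {y : Fin n → ℂ}
    (hf : DifferentiableAt ℝ f y) (hg : DifferentiableAt ℝ g y) :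
    wirtingerBar j (fun y => f y + g y) y = wirtingerBar j f y + wirtingerBar j g y := by
  simp only [wirtingerBar]
  rw [fderiv_fun_add hf hg]
  simp only [_root_.add_apply]
  ring

theorem wirtingerBar_comp_sub_const (j : Fin n) (f : (Fin n → ℂ) → ℂ) (y z : Fin n → ℂ) :
    wirtingerBar j (fun y => f (y - z)) y = wirtingerBar j f (y - z) := by
  simp only [wirtingerBar, fderiv_comp_sub]

/-- First-order form of differentiation under the integral. The integrability clause permits summing
over j inside the integral afterwards. -/
theorem wirtingerBar_integral {Z P : Type} [MeasurableSpace Z] {μ : Measure Z}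
    [NormedAddCommGroup P] [NormedSpace ℝ P] [MeasurableSpace P] [BorelSpace P]
    [SecondCountableTopology P] {w : Z → ℂ} {π : Z → P} {K : Set P} {U : Set (Fin n → ℂ)}
    {O : Set ((Fin n → ℂ) × P)}
    (hw : Integrable w μ) (hπ : Measurable π) (hK : IsCompact K)
    (hwK : ∀ z, w z ≠ 0 → π z ∈ K) (hU : IsOpen U) (hO : IsOpen O) (hUO : U ×ˢ K ⊆ O)
    {h : (Fin n → ℂ) × P → ℂ} (hh : ContDiffOn ℝ ∞ h O) (j : Fin n) {y : Fin n → ℂ} (hy : y ∈ U) :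
    DifferentiableAt ℝ (fun y => ∫ z, w z * h (y, π z) ∂μ) y ∧
    wirtingerBar j (fun y => ∫ z, w z * h (y, π z) ∂μ) y =
        ∫ z, wirtingerBar j (fun y => w z * h (y, π z)) y ∂μ ∧
      Integrable (fun z => wirtingerBar j (fun y => w z * h (y, π z)) y) μ := by
  have hd := hasFDerivAt_integral_smul_comp hw hπ hK hwK hU hO hUO hh hy
  have hi : Integrable (fun z => w z • fderivFst h (y, π z)) μ :=
    integrable_smul_comp hw hπ hK hwK (f := fun p => fderivFst h (y, p))
      ((contDiffOn_fderivFst hO hh).continuousOn.comp (by fun_prop) fun p hp => hUO ⟨hy, hp⟩)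
  have hf : ∀ z, fderiv ℝ (fun y => w z * h (y, π z)) y = w z • fderivFst h (y, π z) := fun z => by
    by_cases hz : w z = 0
    · simp [hz]
    · have := hasFDerivAt_fderivFst hO hh (hUO (a := (y, π z)) ⟨hy, hwK z hz⟩)
      exact (this.const_smul (w z)).fderiv
  have hv : ∀ v, Integrable (fun z => (w z • fderivFst h (y, π z)) v) μ := fun v =>
    hi.apply_continuousLinearMap v
  refine ⟨hd.differentiableAt, ?_, ?_⟩
  · simp only [wirtingerBar, hf]
    have h1 := hd.fderiv
    simp only [smul_eq_mul] at h1
    rw [h1, ContinuousLinearMap.integral_apply hi, ContinuousLinearMap.integral_apply hi,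
      ← integral_const_mul Complex.I, ← integral_add (hv _) ((hv _).const_mul _),
      integral_const_mul]
  · simp only [wirtingerBar, hf]
    exact ((hv _).add ((hv _).const_mul _)).const_mul _

/-- At least one component of c − z is comparable to its norm, so the K_j together are bounded below
by a multiple of ‖c − z‖^{1−2n}. This turns integrability of all K_j(c − z)ρ(z) into integrability
of (1+|z|)^{1−2n}ρ(z). -/
theorem exists_invNorm_pow_le (hn : 1 ≤ n) (c : Fin n → ℂ) :
    ∃ C, ∀ z, z ≠ c → invNorm z ^ (2 * n - 1) ≤ C * ∑ j, ‖bmKernel 0 j (c - z)‖ := by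
  refine ⟨(1 + ‖c‖) ^ (2 * n - 1) * n ^ n, fun z hz => ?_⟩
  set v := c - z with hv
  have hv0 : v ≠ 0 := sub_ne_zero.2 hz.symm
  have hvp := norm_pos_iff.2 hv0
  have hnp : (0 : ℝ) < n := by exact_mod_cast hn
  have h1 : ‖v‖ ≤ (1 + ‖c‖) * (1 + ‖z‖) := by
    have := norm_sub_le c z
    nlinarith [norm_nonneg c, norm_nonneg z]
  have h2 : invNorm z ≤ (1 + ‖c‖) / ‖v‖ := by
    rw [invNorm, le_div_iff₀ hvp, inv_mul_le_iff₀ (by positivity)]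
    linarith
  have h3 : ‖v‖ / (n * ‖v‖ ^ 2) ^ n ≤ ∑ j, ‖bmKernel 0 j v‖ := by
    have h4 : ∀ j, ‖bmKernel 0 j v‖ = ‖v j‖ / sqNorm v ^ n := fun j => by
      rw [bmKernel, norm_div, norm_pow, Complex.norm_real, RCLike.norm_conj, add_zero,
        Real.norm_of_nonneg (sqNorm_nonneg v)]
    simp only [h4, ← Finset.sum_div]
    have := sqNorm_pos hv0
    gcongr
    · refine (pi_norm_le_iff_of_nonneg (by positivity)).2 fun k => ?_
      exact Finset.single_le_sum (f := fun k => ‖v k‖) (fun _ _ => by positivity)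
        (Finset.mem_univ k)
    · exact sqNorm_le v
  calc invNorm z ^ (2 * n - 1) ≤ ((1 + ‖c‖) / ‖v‖) ^ (2 * n - 1) := by
        have := (invNorm_pos z).le
        gcongr
    _ = (1 + ‖c‖) ^ (2 * n - 1) * n ^ n * (‖v‖ / (n * ‖v‖ ^ 2) ^ n) := by
        have h5 : (‖v‖ ^ 2) ^ n = ‖v‖ ^ (2 * n - 1) * ‖v‖ := by
          rw [← pow_succ, ← pow_mul]; congr 1; omega
        rw [mul_pow, h5, div_pow]
        field_simp
    _ ≤ _ := by gcongr

theorem update_mem_conf_eventually {x : Fin 3 → Fin n → ℂ} (hx : x ∈ Conf 3 n) (a : Fin 3) :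
    ∀ᶠ y in 𝓝 (x a), Function.update x a y ∈ Conf 3 n := by
  have h1 : ContinuousAt (fun y => Function.update x a y) (x a) := by fun_prop
  refine h1.eventually_mem ?_
  rw [Function.update_eq_self]
  exact (isOpen_conf 3 n).mem_nhds hx

/-- `∏_{b ≠ a} K_{i_b}(x_b - z)`. -/
noncomputable def kernelProdErase (i : Fin 3 → Fin n) (x : Fin 3 → Fin n → ℂ) (a : Fin 3)
    (z : Fin n → ℂ) : ℂ :=
  ∏ b ∈ Finset.univ.erase a, bmKernel 0 (i b) (x b - z)

theorem kernelProd_update (i : Fin 3 → Fin n) (x : Fin 3 → Fin n → ℂ) (a : Fin 3) (j : Fin n)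
    (y z : Fin n → ℂ) :
    kernelProd (Function.update i a j) (Function.update x a y) z =
      bmKernel 0 j (y - z) * kernelProdErase i x a z := by
  rw [kernelProd, kernelProdErase, ← Finset.mul_prod_erase _ _ (Finset.mem_univ a)]
  congr 1
  · simp
  · refine Finset.prod_congr rfl fun b hb => ?_
    have := Finset.ne_of_mem_erase hb
    simp [this]

variable {r : ℝ} {x : Fin 3 → Fin n → ℂ}

theorem contDiff_cutoff_mul_kernelProdErase (hr : 0 < r)
    (hx : ∀ a b, a ≠ b → 8 * r ≤ ‖x a - x b‖) (i : Fin 3 → Fin n) (a : Fin 3) :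
    ContDiff ℝ ∞ fun z => (cutoff (x a) hr z : ℂ) * kernelProdErase i x a z := by
  refine contDiff_iff_contDiffAt.2 fun z => ?_
  by_cases hz : ‖z - x a‖ < 4 * r
  · refine ContDiffAt.mul ?_ (contDiffAt_prod fun b hb => ?_)
    · exact (Complex.ofRealCLM.contDiff.comp (cutoff (x a) hr).contDiff).contDiffAt
    · refine contDiffAt_bmKernel_comp (i b) (by fun_prop) fun h0 => ?_
      have h4 := hx b a (Finset.ne_of_mem_erase hb)
      rw [sub_eq_zero.1 h0] at h4
      linarith
  · have hev : ∀ᶠ y in 𝓝 z, 3 * r < ‖y - x a‖ :=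
      (isOpen_lt (f := fun _ : Fin n → ℂ => 3 * r) (g := fun y => ‖y - x a‖) continuous_const
        (by fun_prop)).eventually_mem
        (show 3 * r < ‖z - x a‖ by linarith)
    refine (contDiffAt_const (c := (0 : ℂ))).congr_of_eventuallyEq (hev.mono fun y hy => ?_)
    simp [cutoff_eq_zero hr hy.le]

/-- After z ↦ y − z the derivative in y falls on the smooth φ, and the Cauchy–Pompeiu formula
evaluates the sum. -/
theorem wirtingerBar_near_piece (hn : 1 ≤ n) {R : ℝ} {c : Fin n → ℂ} {φ : (Fin n → ℂ) → ℂ}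
    (hφ : ContDiff ℝ ∞ φ) (hR : ∀ z, R ≤ ‖z - c‖ → φ z = 0) :
    (∀ j, DifferentiableAt ℝ (fun y => ∫ z, bmKernel 0 j (y - z) * φ z) c) ∧
    ∑ j, wirtingerBar j (fun y => ∫ z, bmKernel 0 j (y - z) * φ z) c =
      ((Real.pi ^ n / (n - 1).factorial : ℝ) : ℂ) * φ c := by
  have hc : HasCompactSupport φ := by
    refine HasCompactSupport.of_support_subset_isCompact (isCompact_closedBall c R) fun z hz => ?_
    rw [mem_closedBall_iff_norm]
    by_contra h
    exact hz (hR z (not_le.1 h).le)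
  -- The extra 1 allows y to range over the unit ball around c without φ(y − z) leaving the
  -- truncated region.
  set w : Fin n → (Fin n → ℂ) → ℂ := fun j =>
    (Metric.closedBall 0 (R + 1)).indicator (bmKernel 0 j) with hw
  set h : (Fin n → ℂ) × (Fin n → ℂ) → ℂ := fun p => φ (p.1 - p.2) with hh
  have heq : ∀ j, ∀ y ∈ Metric.ball c 1, ∀ z,
      w j z * h (y, id z) = bmKernel 0 j z * φ (y - z) := fun j y hy z => by
    by_cases hz : z ∈ Metric.closedBall 0 (R + 1)
    · simp only [hw, hh, indicator_of_mem hz, id]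
    · have h1 : φ (y - z) = 0 := by
        refine hR _ ?_
        have h2 : ‖y - c‖ < 1 := by simpa [dist_eq_norm] using hy
        have h3 : R + 1 < ‖z‖ := by simpa using hz
        have h4 : z = (y - c) - (y - z - c) := by abel
        have h5 := norm_sub_le (y - c) (y - z - c)
        rw [← h4] at h5
        linarith
      simp only [hh, id, h1, mul_zero]
  have hev : ∀ j, (fun y => ∫ z, bmKernel 0 j (y - z) * φ z) =ᶠ[𝓝 c]
      fun y => ∫ z, w j z * h (y, id z) := fun j => by
    filter_upwards [Metric.ball_mem_nhds c one_pos] with y hy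
    simp only [heq j y hy]
    rw [← integral_sub_left_eq_self (fun z => bmKernel 0 j z * φ (y - z)) volume y]
    simp only [sub_sub_cancel]
  have key := fun j => wirtingerBar_integral (w := w j) (h := h) (U := Metric.ball c 1)
    ((integrable_indicator_iff Metric.isClosed_closedBall.measurableSet).2
      (integrableOn_bmKernel_closedBall le_rfl hn j (R + 1))) measurable_id
    (isCompact_closedBall 0 (R + 1)) (fun z hz => Set.mem_of_indicator_ne_zero hz)
    Metric.isOpen_ball isOpen_univ (subset_univ _)
    (hφ.comp (by fun_prop : ContDiff ℝ ∞ fun p : (Fin n → ℂ) × (Fin n → ℂ) =>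
      p.1 - p.2)).contDiffOn j (Metric.mem_ball_self one_pos)
  refine ⟨fun j => (hev j).differentiableAt_iff.2 (key j).1, ?_⟩
  have h1 : ∀ j z, wirtingerBar j (fun y => w j z * h (y, id z)) c =
      bmKernel 0 j z * wirtingerBar j φ (c - z) := fun j z => by
    have e : (fun y => w j z * h (y, id z)) =ᶠ[𝓝 c] fun y => bmKernel 0 j z * φ (y - z) := by
      filter_upwards [Metric.ball_mem_nhds c one_pos] with y hy using heq j y hy z
    rw [wirtingerBar_congr j e, wirtingerBar_const_mul, wirtingerBar_comp_sub_const]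
    have := hφ.differentiable (by simp)
    fun_prop
  have hint : ∀ j, Integrable fun z => bmKernel 0 j z * wirtingerBar j φ (c - z) := fun j => by
    simpa only [h1] using (key j).2.2
  simp only [wirtingerBar_congr _ (hev _), (key _).2.1, h1]
  rw [← integral_finsetSum _ fun j _ => hint j]
  exact integral_sum_bmKernel_mul_wirtingerBar_sub hn hφ hc c

/-- Since ρ vanishes near c, the derivative may fall on the kernel, which is divergence free away
from the origin. -/
theorem wirtingerBar_far_piece (hn : 1 ≤ n) {δ : ℝ} (hδ : 0 < δ) {c : Fin n → ℂ}
    {ρ : (Fin n → ℂ) → ℂ} (hρm : AEStronglyMeasurable ρ)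
    (hρ : ∀ z, ‖z - c‖ < δ → ρ z = 0)
    (hi : ∀ j, Integrable fun z => bmKernel 0 j (c - z) * ρ z) :
    (∀ j, DifferentiableAt ℝ (fun y => ∫ z, bmKernel 0 j (y - z) * ρ z) c) ∧
    ∑ j, wirtingerBar j (fun y => ∫ z, bmKernel 0 j (y - z) * ρ z) c = 0 := by
  set w : (Fin n → ℂ) → ℂ := fun z => (invNorm z ^ (2 * n - 1) : ℝ) * ρ z with hw
  set h : Fin n → (Fin n → ℂ) × (ℝ × (Fin n → ℂ)) → ℂ := fun j p =>
    bmKernel 0 j (p.2.1 • p.1 - p.2.2) with hh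
  have heq : ∀ j y z, w z * h j (y, (invNorm z, invNorm z • z)) =
      bmKernel 0 j (y - z) * ρ z := fun j y z => by
    simp only [hw, hh, bmKernel_sub_eq hn j y z]
    push_cast
    ring
  have hwi : Integrable w := by
    obtain ⟨C, hC⟩ := exists_invNorm_pow_le hn c
    have h1 : Integrable fun z => C * ∑ j, ‖bmKernel 0 j (c - z) * ρ z‖ :=
      (integrable_finsetSum _ fun j _ => (hi j).norm).const_mul C
    refine h1.mono' (AEStronglyMeasurable.mul ?_ hρm) (Eventually.of_forall fun z => ?_)
    · have := continuous_invNorm (n := n)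
      exact Continuous.aestronglyMeasurable (by fun_prop)
    · by_cases hz : z = c
      · simp [hw, hρ z (by simpa [hz] using hδ)]
      · simp only [hw, norm_mul, ← Finset.sum_mul, ← mul_assoc]
        rw [Complex.norm_real, Real.norm_of_nonneg (by have := invNorm_pos z; positivity)]
        exact mul_le_mul_of_nonneg_right (hC z hz) (norm_nonneg _)
  set O : Set ((Fin n → ℂ) × (ℝ × (Fin n → ℂ))) := {p | p.2.1 • p.1 - p.2.2 ≠ 0} with hO
  have key := fun j => wirtingerBar_integral (w := w) (h := h j) (U := Metric.ball c δ) (O := O)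
    (K := farSet (fun _ : Unit => c) δ) hwi measurable_invNorm_pair (isCompact_farSet _ _)
    (fun z hz => mem_farSet fun _ => by
      by_contra hlt
      exact hz (by simp only [hw, hρ z (not_le.1 hlt), mul_zero]))
    Metric.isOpen_ball (isOpen_ne_fun (by fun_prop) (by fun_prop))
    (fun p hp => smul_sub_ne_zero_of_mem_farSet hp.2 (a := ()) (by
      simpa [dist_eq_norm] using hp.1))
    (fun p hp => ContDiffAt.contDiffWithinAt
      (contDiffAt_bmKernel_comp j (by fun_prop) hp)) j (Metric.mem_ball_self hδ)
  simp only [heq] at key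
  refine ⟨fun j => (key j).1, ?_⟩
  simp only [(key _).2.1]
  rw [← integral_finsetSum _ fun j _ => (key j).2.2]
  refine integral_eq_zero_of_ae (Eventually.of_forall fun z => ?_)
  by_cases hz : ‖z - c‖ < δ
  · simp [hρ z hz, wirtingerBar]
  · have hne : c - z ≠ 0 := by
      rw [← norm_pos_iff, norm_sub_rev]
      linarith
    have h1 : ∀ j, wirtingerBar j (fun y => bmKernel 0 j (y - z) * ρ z) c =
        ρ z * wirtingerBar j (bmKernel 0 j) (c - z) := fun j => by
      simp only [mul_comm _ (ρ z)]
      rw [wirtingerBar_const_mul, wirtingerBar_comp_sub_const]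
      exact (contDiffAt_bmKernel_comp (f := fun y => y - z) j (by fun_prop) hne).differentiableAt
        (by simp)
    have hq : sqNorm (c - z) + 0 ≠ 0 := by simpa using (sqNorm_pos hne).ne'
    simp only [h1, ← Finset.mul_sum, sum_wirtingerBar_bmKernel hq]
    simp

theorem fderiv_kernelIntegral_coordVec (hn : 1 ≤ n) (i : Fin 3 → Fin n) {x : Fin 3 → Fin n → ℂ}
    (hx : x ∈ Conf 3 n) (a : Fin 3) (j : Fin n) (c : ℂ) :
    fderiv ℝ (kernelIntegral i) x (coordVec a j c) =
      fderiv ℝ (fun y => kernelIntegral i (Function.update x a y)) (x a) (Pi.single j c) := by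
  have h1 : DifferentiableAt ℝ (kernelIntegral i) (Function.update x a (x a)) := by
    rw [Function.update_eq_self]
    exact ((contDiffOn_kernelIntegral hn i).contDiffAt
      ((isOpen_conf 3 n).mem_nhds hx)).differentiableAt (by simp)
  have h2 : HasFDerivAt (fun y => kernelIntegral i (Function.update x a y)) _ (x a) :=
    h1.hasFDerivAt.comp (x a) (hasFDerivAt_update x (x a))
  rw [h2.fderiv, Function.update_eq_self, ContinuousLinearMap.comp_apply]
  refine congrArg _ ?_
  funext b
  by_cases hb : b = a
  · subst hb; simp [coordVec]
  · simp [coordVec, hb]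

/-- As a function of x_a the integral is the convolution of K_j with the product of the other two
kernels. A cutoff splits that product into a smooth compactly supported part, on which the
divergence acts as a multiple of δ, and a part vanishing near x_a, which contributes nothing. -/
theorem sum_wirtinger_kernelIntegral (hn : 1 ≤ n) (i : Fin 3 → Fin n) {x : Fin 3 → Fin n → ℂ}
    (hx : x ∈ Conf 3 n) (a : Fin 3) :
    ∑ j, (1 / 2 : ℂ) * (fderiv ℝ (kernelIntegral (Function.update i a j)) x (coordVec a j 1) +
        Complex.I * fderiv ℝ (kernelIntegral (Function.update i a j)) x
          (coordVec a j Complex.I)) =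
      ((Real.pi ^ n / (n - 1).factorial : ℝ) : ℂ) * kernelProdErase i x a (x a) := by
  obtain ⟨r, hr, hsep⟩ := exists_separation hx
  simp only [fderiv_kernelIntegral_coordVec hn _ hx]
  change ∑ j, wirtingerBar j (fun y =>
    kernelIntegral (Function.update i a j) (Function.update x a y)) (x a) = _
  set φ : (Fin n → ℂ) → ℂ := fun z => (cutoff (x a) hr z : ℂ) * kernelProdErase i x a z with hφ
  set ρ : (Fin n → ℂ) → ℂ := fun z => (1 - (cutoff (x a) hr z : ℂ)) * kernelProdErase i x a z
    with hρ
  have hφc : ContDiff ℝ ∞ φ := contDiff_cutoff_mul_kernelProdErase hr hsep i a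
  have hcutm : Measurable fun z => (cutoff (x a) hr z : ℂ) :=
    (Complex.continuous_ofReal.comp (cutoff (x a) hr).continuous).measurable
  have hpm : Measurable (kernelProdErase i x a) :=
    Finset.measurable_fun_prod _ fun b _ =>
      (measurable_bmKernel 0 (i b)).comp (measurable_const.sub measurable_id)
  have hint : ∀ j y, Function.update x a y ∈ Conf 3 n →
      Integrable fun z => bmKernel 0 j (y - z) * kernelProdErase i x a z := fun j y hy =>
    (integrable_kernelProd hn (Function.update i a j) hy).congr
      (Eventually.of_forall fun z => kernelProd_update i x a j y z)
  have hb1 : ∀ z, ‖(cutoff (x a) hr z : ℂ)‖ ≤ 1 := fun z => by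
    rw [Complex.norm_real, Real.norm_of_nonneg (cutoff (x a) hr).nonneg]
    exact (cutoff (x a) hr).le_one
  have hintφ : ∀ j y, Function.update x a y ∈ Conf 3 n →
      Integrable fun z => bmKernel 0 j (y - z) * φ z := fun j y hy => by
    refine ((hint j y hy).bdd_mul hcutm.aestronglyMeasurable (Eventually.of_forall hb1)).congr
      (Eventually.of_forall fun z => ?_)
    simp only [hφ]; ring
  have hintρ : ∀ j y, Function.update x a y ∈ Conf 3 n →
      Integrable fun z => bmKernel 0 j (y - z) * ρ z := fun j y hy => by
    refine ((hint j y hy).sub (hintφ j y hy)).congr (Eventually.of_forall fun z => ?_)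
    simp only [hφ, hρ, Pi.sub_apply]; ring
  have hxa : Function.update x a (x a) ∈ Conf 3 n := by rwa [Function.update_eq_self]
  obtain ⟨dN, hN⟩ := wirtingerBar_near_piece hn (R := 3 * r) (c := x a) hφc fun z hz => by
    simp [hφ, cutoff_eq_zero hr hz]
  obtain ⟨dF, hF⟩ := wirtingerBar_far_piece hn (δ := 2 * r) (c := x a) (ρ := ρ) (by positivity)
    ((measurable_const.sub hcutm).mul hpm).aestronglyMeasurable
    (fun z hz => by simp [hρ, cutoff_eq_one hr hz.le]) (fun j => hintρ j _ hxa)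
  have hev : ∀ j, (fun y => kernelIntegral (Function.update i a j) (Function.update x a y))
      =ᶠ[𝓝 (x a)] fun y => (∫ z, bmKernel 0 j (y - z) * φ z) +
        ∫ z, bmKernel 0 j (y - z) * ρ z := fun j => by
    filter_upwards [update_mem_conf_eventually hx a] with y hy
    rw [← integral_add (hintφ j y hy) (hintρ j y hy), kernelIntegral]
    refine integral_congr_ae (Eventually.of_forall fun z => ?_)
    simp only [kernelProd_update, hφ, hρ]
    ring
  simp only [wirtingerBar_congr _ (hev _), wirtingerBar_add _ (dN _) (dF _),
    Finset.sum_add_distrib]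
  have hφ1 : φ (x a) = kernelProdErase i x a (x a) := by
    simp only [hφ]
    rw [cutoff_eq_one hr (by simp; positivity)]
    simp
  rw [hN, hF, hφ1, add_zero]

/-! ### Translation invariance of the kernel integrals. -/

theorem kernelIntegral_add_const (i : Fin 3 → Fin n) (x : Fin 3 → Fin n → ℂ) (u : Fin n → ℂ) :
    kernelIntegral i (x + fun _ => u) = kernelIntegral i x := by
  rw [kernelIntegral, kernelIntegral, ← integral_sub_right_eq_self (kernelProd i x) u]
  refine integral_congr_ae (Eventually.of_forall fun z => ?_)
  simp only [kernelProd, Pi.add_apply]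
  refine Finset.prod_congr rfl fun a _ => ?_
  congr 1
  abel

/-- The sum is the derivative along a diagonal direction, which vanishes because all three points
may be translated together. -/
theorem sum_fderiv_kernelIntegral (hn : 1 ≤ n) (i : Fin 3 → Fin n) {x : Fin 3 → Fin n → ℂ}
    (hx : x ∈ Conf 3 n) (j : Fin n) (c : ℂ) :
    ∑ a, fderiv ℝ (kernelIntegral i) x (coordVec a j c) = 0 := by
  have h1 : DifferentiableAt ℝ (kernelIntegral i) x :=
    ((contDiffOn_kernelIntegral hn i).contDiffAt
      ((isOpen_conf 3 n).mem_nhds hx)).differentiableAt (by simp)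
  have h2 : ∑ a, coordVec a j c = fun _ : Fin 3 => (Pi.single j c : Fin n → ℂ) := by
    funext b
    simp [coordVec, Finset.sum_apply, Pi.single_apply]
  rw [← map_sum, h2]
  generalize (Pi.single j c : Fin n → ℂ) = u
  have h3 : HasDerivAt (fun t : ℝ => kernelIntegral i (x + t • fun _ : Fin 3 => u)) _ 0 :=
    h1.hasFDerivAt.hasLineDerivAt (fun _ : Fin 3 => u)
  have h4 : (fun t : ℝ => kernelIntegral i (x + t • fun _ : Fin 3 => u)) =
      fun _ => kernelIntegral i x :=
    funext fun t => kernelIntegral_add_const i x (t • u)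
  rw [h4] at h3
  exact h3.unique (hasDerivAt_const _ _)

end KernelDerivative

/-! ### Wedge products of lists of covectors -/

section Wedge

variable {M α : Type*} [AddCommGroup M] [Module ℂ M]

/-- The product of the covectors `θ_k`, `k ∈ l`, in the exterior algebra. -/
noncomputable def wedge (θ : α → M) (l : List α) : ExteriorAlgebra ℂ M :=
  (l.map fun k => ExteriorAlgebra.ι ℂ (θ k)).prod

@[simp] theorem wedge_nil (θ : α → M) : wedge θ [] = 1 := rfl

@[simp] theorem wedge_cons (θ : α → M) (a : α) (l : List α) :
    wedge θ (a :: l) = ExteriorAlgebra.ι ℂ (θ a) * wedge θ l := by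
  simp [wedge]

theorem ι_mul_ι_comm (a b : M) : ExteriorAlgebra.ι ℂ a * ExteriorAlgebra.ι ℂ b =
    -(ExteriorAlgebra.ι ℂ b * ExteriorAlgebra.ι ℂ a) :=
  eq_neg_of_add_eq_zero_left (ExteriorAlgebra.ι_add_mul_swap a b)

theorem ι_mul_wedge (m : M) (θ : α → M) (l : List α) : ExteriorAlgebra.ι ℂ m * wedge θ l =
    (-1 : ℂ) ^ l.length • (wedge θ l * ExteriorAlgebra.ι ℂ m) := by
  induction l with
  | nil => simp
  | cons a t ih =>
    rw [wedge_cons, ← mul_assoc, ι_mul_ι_comm, neg_mul, mul_assoc, ih, mul_smul_comm, ← mul_assoc,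
      List.length_cons, pow_succ, mul_neg_one, neg_smul]

theorem wedge_mul_wedge_comm {β : Type*} (θ : α → M) (l : List α) (η : β → M) (l' : List β) :
    wedge θ l * wedge η l' = (-1 : ℂ) ^ (l.length * l'.length) • (wedge η l' * wedge θ l) := by
  induction l with
  | nil => simp
  | cons a t ih =>
    rw [wedge_cons, mul_assoc, ih, mul_smul_comm, ← mul_assoc, ι_mul_wedge, smul_mul_assoc,
      smul_smul, ← pow_add, List.length_cons, mul_assoc]
    congr 2
    ring

theorem ι_mul_wedge_of_mem (θ : α → M) {k : α} {l : List α} (hk : k ∈ l) :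
    ExteriorAlgebra.ι ℂ (θ k) * wedge θ l = 0 := by
  induction l with
  | nil => simp at hk
  | cons a t ih =>
    rw [wedge_cons, ← mul_assoc]
    rcases List.mem_cons.1 hk with rfl | h
    · rw [ExteriorAlgebra.ι_sq_zero, zero_mul]
    · rw [ι_mul_ι_comm, neg_mul, mul_assoc, ih h, mul_zero, neg_zero]

theorem ι_mul_wedge_filter [DecidableEq α] (θ : α → M) {i : α} {l : List α} (hl : l.Nodup)
    (hi : i ∈ l) : ExteriorAlgebra.ι ℂ (θ i) * wedge θ (l.filter (fun k => k ≠ i)) =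
      (-1 : ℂ) ^ l.idxOf i • wedge θ l := by
  induction l with
  | nil => simp at hi
  | cons a t ih =>
    rw [List.nodup_cons] at hl
    by_cases h : a = i
    · subst h
      have : t.filter (fun k => k ≠ a) = t := by
        rw [List.filter_eq_self]
        intro b hb
        have hne : b ≠ a := fun h => hl.1 (h ▸ hb)
        simpa using hne
      rw [List.filter_cons_of_neg (by simp), this]
      simp
    · have hi' : i ∈ t := (List.mem_cons.1 hi).resolve_left (Ne.symm h)
      rw [List.filter_cons_of_pos (by simpa using h), wedge_cons, ← mul_assoc, ι_mul_ι_comm,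
        neg_mul, mul_assoc, ih hl.2 hi', List.idxOf_cons_ne _ h, wedge_cons, mul_smul_comm,
        pow_succ, mul_neg_one, neg_smul]

theorem wedge_mul_ι_of_mem (θ : α → M) {k : α} {l : List α} (hk : k ∈ l) :
    wedge θ l * ExteriorAlgebra.ι ℂ (θ k) = 0 := by
  have h := ι_mul_wedge (θ k) θ l
  rw [ι_mul_wedge_of_mem θ hk] at h
  exact (smul_eq_zero.1 h.symm).resolve_left (pow_ne_zero _ (by norm_num))

/-- Every θ_k with k in `l` is killed by `wedge θ l`, so f and g agree modulo what the left factor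
annihilates. -/
theorem wedge_mul_wedge_congr {θ f g : α → M} {l l' : List α}
    (h : ∀ k ∈ l', k ∈ l ∧ f k = g k + θ k) : wedge θ l * wedge f l' = wedge θ l * wedge g l' := by
  induction l' with
  | nil => simp
  | cons a t ih =>
    obtain ⟨ha, he⟩ := h a List.mem_cons_self
    have hs : wedge θ l * ExteriorAlgebra.ι ℂ (g a) =
        (-1 : ℂ) ^ l.length • (ExteriorAlgebra.ι ℂ (g a) * wedge θ l) := by
      rw [ι_mul_wedge, smul_smul, ← mul_pow]
      simp
    rw [wedge_cons, wedge_cons, he, map_add, add_mul, mul_add, ← mul_assoc _ _ (wedge f t),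
      ← mul_assoc _ _ (wedge f t), wedge_mul_ι_of_mem θ ha, zero_mul, add_zero, ← mul_assoc, hs,
      smul_mul_assoc, smul_mul_assoc, mul_assoc, mul_assoc,
      ih fun k hk => h k (List.mem_cons_of_mem a hk)]

theorem wedge_neg (θ : α → M) (l : List α) :
    wedge (fun k => -θ k) l = (-1 : ℂ) ^ l.length • wedge θ l := by
  induction l with
  | nil => simp
  | cons a t ih =>
    rw [wedge_cons, wedge_cons, ih, map_neg, mul_smul_comm, List.length_cons, pow_succ]
    simp

theorem wedge_mem_pow {S : Submodule ℂ (ExteriorAlgebra ℂ M)} {θ : α → M} {l : List α}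
    (h : ∀ k ∈ l, ExteriorAlgebra.ι ℂ (θ k) ∈ S) : wedge θ l ∈ S ^ l.length := by
  induction l with
  | nil => simp
  | cons a t ih =>
    rw [wedge_cons, List.length_cons, pow_succ']
    exact Submodule.mul_mem_mul (h a List.mem_cons_self)
      (ih fun k hk => h k (List.mem_cons_of_mem a hk))

theorem length_finRange_filter {n : ℕ} (j : Fin n) :
    ((List.finRange n).filter (fun k => k ≠ j)).length = n - 1 := by
  rw [← List.toFinset_card_of_nodup ((List.nodup_finRange n).filter _)]
  have : ((List.finRange n).filter (fun k => k ≠ j)).toFinset = Finset.univ.erase j := by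
    ext k; simp
  rw [this]
  simp

/-- The `q`-th power of a submodule, zero for negative `q`. -/
def zpowSubmodule (S : Submodule ℂ (ExteriorAlgebra ℂ M)) (q : ℤ) :
    Submodule ℂ (ExteriorAlgebra ℂ M) :=
  if 0 ≤ q then S ^ q.toNat else ⊥

end Wedge

/-! ### Interior products and the fiber component -/

section Contraction

variable {E F : Type*} [AddCommGroup E] [Module ℝ E] [AddCommGroup F] [Module ℝ F]

theorem interiorProd_ι_mul (v : E) (l : Cotangent E) (η : Ext E) :
    interiorProd v (ExteriorAlgebra.ι ℂ l * η) =
      l v • η - ExteriorAlgebra.ι ℂ l * interiorProd v η :=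
  CliffordAlgebra.contractLeft_ι_mul _ _ _

theorem interiorProd_one (v : E) : interiorProd v (1 : Ext E) = 0 :=
  CliffordAlgebra.contractLeft_one (Q := (0 : QuadraticForm ℂ (Cotangent E))) _

theorem interiorProd_wedge_eq_zero {α : Type*} (v : E) {θ : α → Cotangent E} {l : List α}
    (h : ∀ k ∈ l, θ k v = 0) : interiorProd v (wedge θ l) = 0 := by
  induction l with
  | nil => exact interiorProd_one v
  | cons a t ih =>
    rw [wedge_cons, interiorProd_ι_mul, h a List.mem_cons_self,
      ih fun k hk => h k (List.mem_cons_of_mem a hk)]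
    simp

theorem interiorProd_wedge_mul {α : Type*} (v : E) {θ : α → Cotangent E} {l : List α}
    (h : ∀ k ∈ l, θ k v = 0) (η : Ext E) :
    interiorProd v (wedge θ l * η) = (-1 : ℂ) ^ l.length • (wedge θ l * interiorProd v η) := by
  induction l with
  | nil => simp
  | cons a t ih =>
    rw [wedge_cons, mul_assoc, interiorProd_ι_mul, h a List.mem_cons_self,
      ih fun k hk => h k (List.mem_cons_of_mem a hk), List.length_cons, pow_succ, mul_neg_one,
      neg_smul, mul_assoc, mul_smul_comm, zero_smul, zero_sub]

/-- Integer degrees keep the count uniform: contracting a scalar lands in degree −1, which is zero.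
This is what handles n = 1. -/
theorem interiorProd_mem (v : E) {S : Submodule ℂ (Ext E)}
    (hS : S ≤ LinearMap.range (ExteriorAlgebra.ι ℂ)) {q : ℤ} {η : Ext E}
    (hη : η ∈ zpowSubmodule S q) : interiorProd v η ∈ zpowSubmodule S (q - 1) := by
  have key : ∀ N : ℕ, ∀ η ∈ S ^ N, interiorProd v η ∈ zpowSubmodule S ((N : ℤ) - 1) := by
    intro N
    induction N with
    | zero =>
      intro η hη
      obtain ⟨c, rfl⟩ := Submodule.mem_one.1 (by simpa using hη)
      rw [Algebra.algebraMap_eq_smul_one, map_smul, interiorProd_one, smul_zero]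
      exact Submodule.zero_mem _
    | succ N ih =>
      intro η hη
      have e : zpowSubmodule S (((N + 1 : ℕ) : ℤ) - 1) = S ^ N := by simp [zpowSubmodule]
      rw [e]
      rw [pow_succ'] at hη
      refine Submodule.mul_induction_on hη (fun s hs ξ hξ => ?_) fun x y hx hy => ?_
      · obtain ⟨l, rfl⟩ := hS hs
        rw [interiorProd_ι_mul]
        refine Submodule.sub_mem _ (Submodule.smul_mem _ _ hξ) ?_
        have h1 := ih ξ hξ
        rcases N with _ | N
        · have : interiorProd v ξ = 0 := by simpa [zpowSubmodule] using h1
          rw [this, mul_zero]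
          exact Submodule.zero_mem _
        · have e' : zpowSubmodule S (((N + 1 : ℕ) : ℤ) - 1) = S ^ N := by simp [zpowSubmodule]
          rw [e'] at h1
          rw [pow_succ']
          exact Submodule.mul_mem_mul hs h1
      · rw [map_add]
        exact Submodule.add_mem _ hx hy
  by_cases hq : 0 ≤ q
  · obtain ⟨N, rfl⟩ := Int.eq_ofNat_of_zero_le hq
    exact key N η (by simpa [zpowSubmodule] using hη)
  · have : η = 0 := by simpa [zpowSubmodule, hq] using hη
    rw [this, map_zero]
    exact Submodule.zero_mem _

theorem extComap_ι (L : E →ₗ[ℝ] F) (l : Cotangent F) :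
    extComap L (ExteriorAlgebra.ι ℂ l) = ExteriorAlgebra.ι ℂ (l ∘ₗ L) :=
  ExteriorAlgebra.map_apply_ι _ _

theorem extComap_wedge {α : Type*} (L : E →ₗ[ℝ] F) (θ : α → Cotangent F) (l : List α) :
    extComap L (wedge θ l) = wedge (fun k => θ k ∘ₗ L) l := by
  induction l with
  | nil => simp
  | cons a t ih => rw [wedge_cons, wedge_cons, map_mul, extComap_ι, ih]

theorem extComap_mem (L : E →ₗ[ℝ] F) {S : Submodule ℂ (Ext F)} {S' : Submodule ℂ (Ext E)}
    (hS : ∀ s ∈ S, extComap L s ∈ S') {q : ℤ} {η : Ext F} (hη : η ∈ zpowSubmodule S q) :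
    extComap L η ∈ zpowSubmodule S' q := by
  unfold zpowSubmodule at hη ⊢
  split_ifs at hη ⊢ with hq
  · have h1 : extComap L η ∈ (S ^ q.toNat).map (extComap L).toLinearMap := ⟨η, hη, rfl⟩
    rw [Submodule.map_pow] at h1
    exact pow_le_pow_left' (Submodule.map_le_iff_le_comap.2 hS) _ h1
  · rw [(Submodule.mem_bot ℂ).1 hη, map_zero]
    exact Submodule.zero_mem _

variable {m n : ℕ}

/-- Contraction with `e_i, √-1 e_i` of the last factor for all `i` in the list. -/
noncomputable def contractList (m : ℕ) {n : ℕ} : List (Fin n) →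
    Ext (Fin (m + 1) → Fin n → ℂ) →ₗ[ℂ] Ext (Fin (m + 1) → Fin n → ℂ)
  | [] => LinearMap.id
  | i :: t => contractList m t ∘ₗ interiorProd (coordVec (Fin.last m) i Complex.I) ∘ₗ
      interiorProd (coordVec (Fin.last m) i 1)

theorem foldl_interiorProd (l : List (Fin n)) (η : Ext (Fin (m + 1) → Fin n → ℂ)) :
    l.foldl (fun ξ i => interiorProd (coordVec (Fin.last m) i Complex.I)
        (interiorProd (coordVec (Fin.last m) i 1) ξ)) η = contractList m l η := by
  induction l generalizing η with
  | nil => rfl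
  | cons a t ih => rw [List.foldl_cons, ih]; rfl

/-- `fiberComponent` as a linear map. -/
noncomputable def fiberComponentLin (m n : ℕ) :
    Ext (Fin (m + 1) → Fin n → ℂ) →ₗ[ℂ] Ext (Fin m → Fin n → ℂ) :=
  (extComap (horizontal m n)).toLinearMap ∘ₗ contractList m (List.finRange n)

theorem fiberComponent_eq (η : Ext (Fin (m + 1) → Fin n → ℂ)) :
    fiberComponent η = fiberComponentLin m n η := by
  rw [fiberComponent, foldl_interiorProd]
  rfl

/-- Covectors that vanish on the fiber pass each contraction with sign (−1)^{|l|}, and contractions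
come in pairs. -/
theorem contractList_wedge_mul {α : Type*} {θ : α → Cotangent (Fin (m + 1) → Fin n → ℂ)}
    {l : List α} (h : ∀ k ∈ l, ∀ i c, θ k (coordVec (Fin.last m) i c) = 0) (L : List (Fin n))
    (η : Ext (Fin (m + 1) → Fin n → ℂ)) :
    contractList m L (wedge θ l * η) = wedge θ l * contractList m L η := by
  induction L generalizing η with
  | nil => rfl
  | cons a t ih =>
    simp only [contractList, LinearMap.comp_apply]
    rw [interiorProd_wedge_mul _ fun k hk => h k hk a 1, map_smul,
      interiorProd_wedge_mul _ fun k hk => h k hk a Complex.I, smul_smul, ← mul_pow]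
    simp [ih]

theorem fiberComponentLin_wedge_mul {α : Type*} {θ : α → Cotangent (Fin (m + 1) → Fin n → ℂ)}
    {l : List α} (h : ∀ k ∈ l, ∀ i c, θ k (coordVec (Fin.last m) i c) = 0)
    (η : Ext (Fin (m + 1) → Fin n → ℂ)) :
    fiberComponentLin m n (wedge θ l * η) =
      wedge (fun k => θ k ∘ₗ horizontal m n) l * fiberComponentLin m n η := by
  simp only [fiberComponentLin, LinearMap.comp_apply, contractList_wedge_mul h,
    AlgHom.toLinearMap_apply, map_mul, extComap_wedge]

theorem coordFun_coordVec (a b : Fin m) (i j : Fin n) (c : ℂ) :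
    coordFun a i (coordVec b j c) = if a = b ∧ i = j then c else 0 := by
  by_cases h : a = b
  · subst h
    by_cases h' : i = j
    · subst h'; simp [coordFun, coordVec]
    · simp [coordFun, coordVec, h']
  · simp [coordFun, coordVec, h]

/-- On the fiber θ_k restricts to −dz̄_k, and dz ∧ (−dz̄) = 2i dx ∧ dy. Regrouping dz_1⋯dz_n θ_1⋯θ_n
into pairs costs (−1)^{n(n−1)/2}. -/
theorem contractList_wedge_mul_wedge {θ : Fin n → Cotangent (Fin (m + 1) → Fin n → ℂ)}
    (hθ : ∀ k i c, θ k (coordVec (Fin.last m) i c) = if k = i then -(starRingEnd ℂ) c else 0)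
    {l : List (Fin n)} (hl : l.Nodup) :
    contractList m l (wedge (fun i => coordFun (Fin.last m) i) l * wedge θ l) =
      ((-1 : ℂ) ^ (l.length * (l.length - 1) / 2) * (2 * Complex.I) ^ l.length) • 1 := by
  induction l with
  | nil => simp [contractList]
  | cons a t ih =>
    rw [List.nodup_cons] at hl
    set dzl : Fin n → Cotangent (Fin (m + 1) → Fin n → ℂ) := fun i => coordFun (Fin.last m) i
    have hdz : ∀ k i c, dzl k (coordVec (Fin.last m) i c) = if k = i then c else 0 := fun k i c => by
      simp [dzl, coordFun_coordVec]
    set R := wedge dzl t * wedge θ t with hR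
    have hne : ∀ k ∈ t, k ≠ a := fun k hk h => hl.1 (h ▸ hk)
    have hR0 : ∀ c, interiorProd (coordVec (Fin.last m) a c) R = 0 := fun c => by
      rw [hR, interiorProd_wedge_mul _ (fun k hk => by rw [hdz, if_neg (hne k hk)]),
        interiorProd_wedge_eq_zero _ (fun k hk => by rw [hθ, if_neg (hne k hk)])]
      simp
    have hswap : wedge dzl (a :: t) * wedge θ (a :: t) = (-1 : ℂ) ^ t.length •
        (ExteriorAlgebra.ι ℂ (dzl a) * (ExteriorAlgebra.ι ℂ (θ a) * R)) := by
      have hs : wedge dzl t * ExteriorAlgebra.ι ℂ (θ a) =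
          (-1 : ℂ) ^ t.length • (ExteriorAlgebra.ι ℂ (θ a) * wedge dzl t) := by
        rw [ι_mul_wedge, smul_smul, ← mul_pow]
        simp
      rw [wedge_cons, wedge_cons, mul_assoc, ← mul_assoc (wedge dzl t), hs, smul_mul_assoc,
        mul_smul_comm, hR, mul_assoc]
    have hcon : interiorProd (coordVec (Fin.last m) a Complex.I)
        (interiorProd (coordVec (Fin.last m) a 1)
          (ExteriorAlgebra.ι ℂ (dzl a) * (ExteriorAlgebra.ι ℂ (θ a) * R))) =
        (2 * Complex.I) • R := by
      simp only [interiorProd_ι_mul, map_sub, map_smul, hR0, hdz, hθ, if_true, mul_zero, map_one,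
        Complex.conj_I, sub_zero, mul_smul_comm]
      module
    rw [hswap, map_smul]
    simp only [contractList, LinearMap.comp_apply]
    rw [hcon, map_smul, ih hl.2, smul_smul, smul_smul, List.length_cons, Nat.add_sub_cancel]
    congr 1
    have h2 : (t.length + 1) * t.length / 2 = t.length + t.length * (t.length - 1) / 2 := by
      rcases t.length with _ | k
      · rfl
      · have : (k + 1 + 1) * (k + 1) = (k + 1) * (k + 1 - 1) + 2 * (k + 1) := by
          rw [Nat.add_sub_cancel]; ring
        rw [this, Nat.add_mul_div_left _ _ (by norm_num)]
        ring
    rw [h2, pow_add, pow_succ]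
    ring

theorem contractList_mem {S : Submodule ℂ (Ext (Fin (m + 1) → Fin n → ℂ))}
    (hS : S ≤ LinearMap.range (ExteriorAlgebra.ι ℂ)) (l : List (Fin n)) {q : ℤ}
    {η : Ext (Fin (m + 1) → Fin n → ℂ)} (hη : η ∈ zpowSubmodule S q) :
    contractList m l η ∈ zpowSubmodule S (q - 2 * l.length) := by
  induction l generalizing q η with
  | nil => simpa [contractList] using hη
  | cons a t ih =>
    have h := ih (interiorProd_mem (coordVec (Fin.last m) a Complex.I) hS
      (interiorProd_mem (coordVec (Fin.last m) a 1) hS hη))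
    have e : q - 1 - 1 - 2 * (t.length : ℤ) = q - 2 * ((a :: t).length : ℤ) := by
      rw [List.length_cons]; push_cast; ring
    rwa [e] at h

theorem bidegree_zero (m n : ℕ) (q : ℤ) : bidegree m n 0 q =
    zpowSubmodule (Submodule.span ℂ (Set.range fun s : Fin m × Fin n => dzbar s.1 s.2)) q := by
  simp [bidegree, zpowSubmodule]

end Contraction

/-! ### The algebra of the forms `ω_{ab}` -/

section OmegaAlgebra

variable {m n : ℕ}

/-- `dz̄^a_k - dz̄^b_k`. -/
noncomputable def theta (a b : Fin m) (k : Fin n) : Cotangent (Fin m → Fin n → ℂ) :=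
  conjLin ∘ₗ coordFun a k - conjLin ∘ₗ coordFun b k

/-- The product of the `dz̄^a_k - dz̄^b_k` over all `k`. -/
noncomputable def volWedge (a b : Fin m) : Ext (Fin m → Fin n → ℂ) :=
  wedge (theta a b) (List.finRange n)

/-- The product of the `dz̄^a_k - dz̄^b_k` over all `k ≠ j`. -/
noncomputable def omitWedge (a b : Fin m) (j : Fin n) : Ext (Fin m → Fin n → ℂ) :=
  wedge (theta a b) ((List.finRange n).filter (fun k => k ≠ j))

/-- The constant in the Bochner-Martinelli form. -/
noncomputable def bmConst (n : ℕ) : ℂ :=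
  (-1) ^ (n * (n - 1) / 2 + 1) * ((n - 1).factorial : ℂ) / (2 * Real.pi * Complex.I) ^ n

/-- The coefficient of `K_j` in the Bochner-Martinelli form. -/
noncomputable def bmCoeff (j : Fin n) : ℂ := bmConst n * (-1) ^ ((j : ℕ) + 1)

/-- The map x ↦ x_a − x_b is linear, so its pullback of each constant form is constant and all
dependence on x lies in scalar kernels. -/
theorem omegaPair_eq (a b : Fin m) (x : Fin m → Fin n → ℂ) :
    omegaPair a b x = ∑ j, (bmCoeff j * bmKernel 0 j (x a - x b)) • omitWedge a b j := by
  have hf : HasFDerivAt (fun x : Fin m → Fin n → ℂ => x a - x b)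
      (ContinuousLinearMap.proj (R := ℝ) a - ContinuousLinearMap.proj b) x :=
    (hasFDerivAt_apply (𝕜 := ℝ) a x).sub (hasFDerivAt_apply b x)
  have homit : ∀ j : Fin n, dzbarOmit j =
      wedge (fun k => conjLin ∘ₗ (LinearMap.proj k : Cotangent (Fin n → ℂ)))
        ((List.finRange n).filter (fun k => k ≠ j)) := fun j => rfl
  have hth : (fun k => (conjLin ∘ₗ (LinearMap.proj k : Cotangent (Fin n → ℂ))) ∘ₗ
      ((ContinuousLinearMap.proj (R := ℝ) (φ := fun _ : Fin m => Fin n → ℂ) a -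
        ContinuousLinearMap.proj b : (Fin m → Fin n → ℂ) →L[ℝ] (Fin n → ℂ)) :
          (Fin m → Fin n → ℂ) →ₗ[ℝ] (Fin n → ℂ))) = theta a b := by
    funext k
    refine LinearMap.ext fun v => ?_
    simp [theta, coordFun, conjLin]
  rw [omegaPair, pullback, hf.fderiv, bmForm, map_smul, map_sum, Finset.smul_sum]
  refine Finset.sum_congr rfl fun j _ => ?_
  rw [map_smul, homit, extComap_wedge, hth, smul_smul, omitWedge]
  congr 1
  simp only [bmCoeff, bmConst, bmKernel, sqNorm, add_zero]
  ring

theorem omitWedge_swap (a b : Fin m) (j : Fin n) :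
    omitWedge b a j = (-1 : ℂ) ^ (n - 1) • omitWedge a b j := by
  have h : theta b a = fun k : Fin n => -theta a b k := by
    funext k; simp [theta]
  rw [omitWedge, h, wedge_neg, length_finRange_filter, omitWedge]

theorem omegaPair_swap (hn : 1 ≤ n) (a b : Fin m) (x : Fin m → Fin n → ℂ) :
    omegaPair b a x = (-1 : ℂ) ^ n • omegaPair a b x := by
  rw [omegaPair_eq, omegaPair_eq, Finset.smul_sum]
  refine Finset.sum_congr rfl fun j _ => ?_
  have hp : (-1 : ℂ) ^ n = (-1) ^ (n - 1) * (-1) := by rw [← pow_succ, Nat.sub_add_cancel hn]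
  rw [omitWedge_swap a b, ← neg_sub (x a), bmKernel_neg, smul_smul, smul_smul, hp]
  congr 1
  ring

theorem omitWedge_mul_comm (a b c d : Fin m) (j k : Fin n) :
    omitWedge a b j * omitWedge c d k =
      (-1 : ℂ) ^ ((n - 1) * (n - 1)) • (omitWedge c d k * omitWedge a b j) := by
  rw [omitWedge, omitWedge, wedge_mul_wedge_comm, length_finRange_filter, length_finRange_filter]

theorem sum_smul_mul_sum_smul {A ι κ : Type*} [Fintype ι] [Fintype κ] [Ring A] [Algebra ℂ A]
    (c : ι → ℂ) (u : ι → A) (d : κ → ℂ) (v : κ → A) :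
    (∑ j, c j • u j) * (∑ k, d k • v k) = ∑ j, ∑ k, (c j * d k) • (u j * v k) := by
  simp only [Finset.sum_mul_sum, smul_mul_smul_comm]

theorem omegaPair_mul_eq (a b c d : Fin m) (x : Fin m → Fin n → ℂ) :
    omegaPair a b x * omegaPair c d x = ∑ j, ∑ k, (bmCoeff j * bmKernel 0 j (x a - x b) *
      (bmCoeff k * bmKernel 0 k (x c - x d))) • (omitWedge a b j * omitWedge c d k) := by
  rw [omegaPair_eq, omegaPair_eq, sum_smul_mul_sum_smul]

theorem omegaPair_mul_comm (a b c d : Fin m) (x : Fin m → Fin n → ℂ) :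
    omegaPair a b x * omegaPair c d x =
      (-1 : ℂ) ^ ((n - 1) * (n - 1)) • (omegaPair c d x * omegaPair a b x) := by
  rw [omegaPair_mul_eq, omegaPair_mul_eq, Finset.sum_comm, Finset.smul_sum]
  refine Finset.sum_congr rfl fun k _ => ?_
  rw [Finset.smul_sum]
  refine Finset.sum_congr rfl fun j _ => ?_
  rw [omitWedge_mul_comm, smul_smul, smul_smul]
  congr 1
  ring

/-- A covector already present gives zero; the omitted one moves past its j predecessors. This
Kronecker delta reduces ∂̄ to a divergence. -/
theorem ι_theta_mul_omitWedge (a b : Fin m) (i j : Fin n) :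
    ExteriorAlgebra.ι ℂ (theta a b i) * omitWedge a b j =
      if i = j then (-1 : ℂ) ^ (j : ℕ) • volWedge a b else 0 := by
  split_ifs with h
  · subst h
    rw [omitWedge, ι_mul_wedge_filter _ (List.nodup_finRange n) (List.mem_finRange i),
      List.idxOf_finRange, volWedge]
  · exact ι_mul_wedge_of_mem _ (by simpa using h)

/-! ### The fiber component of the kernel -/

theorem addPoint_castSucc (x : Fin m → Fin n → ℂ) (z : Fin n → ℂ) (a : Fin m) :
    addPoint x z a.castSucc = x a := by
  simp [addPoint]

theorem addPoint_last (x : Fin m → Fin n → ℂ) (z : Fin n → ℂ) :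
    addPoint x z (Fin.last m) = z := by
  simp [addPoint]

theorem coordFun_castSucc_comp_horizontal (a : Fin m) (k : Fin n) :
    coordFun a.castSucc k ∘ₗ horizontal m n = coordFun a k := by
  refine LinearMap.ext fun v => ?_
  change addPoint v 0 a.castSucc k = v a k
  rw [addPoint_castSucc]

theorem coordFun_last_comp_horizontal (k : Fin n) :
    coordFun (Fin.last m) k ∘ₗ horizontal m n = 0 := by
  refine LinearMap.ext fun v => ?_
  change addPoint v 0 (Fin.last m) k = 0
  rw [addPoint_last]
  rfl

theorem theta_castSucc_comp_horizontal (a b : Fin m) (k : Fin n) :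
    theta a.castSucc b.castSucc k ∘ₗ horizontal m n = theta a b k := by
  rw [theta, LinearMap.sub_comp, LinearMap.comp_assoc, LinearMap.comp_assoc,
    coordFun_castSucc_comp_horizontal, coordFun_castSucc_comp_horizontal, theta]

theorem conj_coordFun_castSucc_coordVec (a : Fin m) (k i : Fin n) (c : ℂ) :
    (conjLin ∘ₗ coordFun a.castSucc k) (coordVec (Fin.last m) i c) = 0 := by
  rw [LinearMap.comp_apply, coordFun_coordVec, if_neg fun h => (Fin.castSucc_lt_last a).ne h.1,
    map_zero]

theorem theta_castSucc_coordVec (a b : Fin m) (k i : Fin n) (c : ℂ) :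
    theta a.castSucc b.castSucc k (coordVec (Fin.last m) i c) = 0 := by
  rw [theta, LinearMap.sub_apply, conj_coordFun_castSucc_coordVec,
    conj_coordFun_castSucc_coordVec, sub_zero]

theorem theta_last_coordVec (a : Fin m) (k i : Fin n) (c : ℂ) :
    theta a.castSucc (Fin.last m) k (coordVec (Fin.last m) i c) =
      if k = i then -(starRingEnd ℂ) c else 0 := by
  rw [theta, LinearMap.sub_apply, conj_coordFun_castSucc_coordVec, LinearMap.comp_apply,
    coordFun_coordVec]
  by_cases h : k = i <;> simp [h, conjLin]

/-- `dz_1 ⋯ dz_n` in the last factor. -/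
noncomputable def dzLast (m n : ℕ) : Ext (Fin (m + 1) → Fin n → ℂ) :=
  wedge (fun i => coordFun (Fin.last m) i) (List.finRange n)

/-- The value of the fiber component on `dz_1 ⋯ dz_n (dz̄^a_1 - dz̄_1) ⋯ (dz̄^a_n - dz̄_n)`. -/
noncomputable def fiberConst (n : ℕ) : ℂ := (-1) ^ (n * (n - 1) / 2) * (2 * Complex.I) ^ n

theorem fiberComponentLin_dzLast_mul_volWedge (a : Fin m) :
    fiberComponentLin m n (dzLast m n * volWedge a.castSucc (Fin.last m)) =
      fiberConst n • 1 := by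
  rw [fiberComponentLin, LinearMap.comp_apply, dzLast, volWedge,
    contractList_wedge_mul_wedge (theta_last_coordVec a) (List.nodup_finRange n), map_smul,
    List.length_finRange, fiberConst]
  simp

theorem even_sign {p q : ℕ} (h : Even (p + q)) (r : ℕ) :
    (-1 : ℂ) ^ (r * p) * (-1) ^ (r * q) = 1 := by
  rw [← pow_add, ← mul_add]
  exact (h.mul_left r).neg_one_pow

theorem volWedge_mul_omitWedge (a b : Fin m) (k : Fin n) :
    volWedge a.castSucc (Fin.last m) * omitWedge b.castSucc (Fin.last m) k =
      volWedge a.castSucc (Fin.last m) * omitWedge b.castSucc a.castSucc k := by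
  refine wedge_mul_wedge_congr fun i _ => ⟨List.mem_finRange i, ?_⟩
  simp only [theta]
  abel

theorem fiberComponentLin_omitWedge_mul (a b : Fin m) (k : Fin n)
    (η : Ext (Fin (m + 1) → Fin n → ℂ)) :
    fiberComponentLin m n (omitWedge a.castSucc b.castSucc k * η) =
      omitWedge a b k * fiberComponentLin m n η := by
  rw [omitWedge, fiberComponentLin_wedge_mul fun k _ i c => theta_castSucc_coordVec a b k i c]
  simp only [theta_castSucc_comp_horizontal, omitWedge]

/-- The top product for a turns the other differences from the fiber point into differences from a,
which are forms of the base. These move out past dz_1⋯dz_n and past the top product, and the two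
signs (−1)^{n(n−1)} cancel. -/
theorem fiberComponentLin_volWedge_mul (a b c : Fin m) (k l : Fin n) :
    fiberComponentLin m n (dzLast m n * (volWedge a.castSucc (Fin.last m) *
        (omitWedge b.castSucc (Fin.last m) k * omitWedge c.castSucc (Fin.last m) l))) =
      fiberConst n • (omitWedge b a k * omitWedge c a l) := by
  set V : Ext (Fin (m + 1) → Fin n → ℂ) := volWedge a.castSucc (Fin.last m) with hV
  set B : Ext (Fin (m + 1) → Fin n → ℂ) := omitWedge b.castSucc a.castSucc k with hB
  set C : Ext (Fin (m + 1) → Fin n → ℂ) := omitWedge c.castSucc a.castSucc l with hC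
  have hVB : ∀ (d : Fin m) (j : Fin n), V * omitWedge d.castSucc a.castSucc j =
      (-1 : ℂ) ^ ((n - 1) * n) • (omitWedge d.castSucc a.castSucc j * V) := fun d j => by
    rw [hV, volWedge, omitWedge, wedge_mul_wedge_comm, length_finRange_filter,
      List.length_finRange, mul_comm n]
  have hZB : ∀ (d : Fin m) (j : Fin n), dzLast m n * omitWedge d.castSucc a.castSucc j =
      (-1 : ℂ) ^ ((n - 1) * n) • (omitWedge d.castSucc a.castSucc j * dzLast m n) := fun d j => by
    rw [dzLast, omitWedge, wedge_mul_wedge_comm, length_finRange_filter,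
      List.length_finRange, mul_comm n]
  have hsq : (-1 : ℂ) ^ ((n - 1) * n) * (-1) ^ ((n - 1) * n) = 1 := even_sign ⟨n, rfl⟩ _
  have hcomm : ∀ (d : Fin m) (j : Fin n), dzLast m n * (V * omitWedge d.castSucc a.castSucc j) =
      omitWedge d.castSucc a.castSucc j * (dzLast m n * V) := fun d j => by
    rw [hVB, mul_smul_comm, ← mul_assoc, hZB, smul_mul_assoc, smul_smul, hsq, one_smul, mul_assoc]
  have hstep : V * (omitWedge b.castSucc (Fin.last m) k * omitWedge c.castSucc (Fin.last m) l) =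
      V * B * C := by
    rw [← mul_assoc, hV, volWedge_mul_omitWedge, ← hV, hVB b, smul_mul_assoc, mul_assoc, hV,
      volWedge_mul_omitWedge, ← hV, ← hB, ← hC, ← mul_assoc, smul_mul_assoc]
  rw [hstep, ← mul_assoc, hcomm b k, mul_assoc, mul_assoc, hcomm c l,
    fiberComponentLin_omitWedge_mul, fiberComponentLin_omitWedge_mul,
    fiberComponentLin_dzLast_mul_volWedge, mul_smul_comm, mul_smul_comm, mul_one]

/-- `Ω^1_j Ω^2_k Ω^3_l`, where `Ω^a_j` omits the index `j` from the differences
`dz̄^a - dz̄^4`. -/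
noncomputable def tripleWedge (j k l : Fin n) : Ext (Fin 4 → Fin n → ℂ) :=
  omitWedge (0 : Fin 3).castSucc (Fin.last 3) j * omitWedge (1 : Fin 3).castSucc (Fin.last 3) k *
    omitWedge (2 : Fin 3).castSucc (Fin.last 3) l

/-- The fiber component of `dz^4_1 ⋯ dz^4_n Ω^1_j Ω^2_k Ω^3_l`. -/
noncomputable def fiberTerm (j k l : Fin n) : Ext (Fin 3 → Fin n → ℂ) :=
  fiberComponentLin 3 n (dzLast 3 n * tripleWedge j k l)

theorem tripleWedge_eq_one (j k l : Fin n) : tripleWedge j k l =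
    (-1 : ℂ) ^ ((n - 1) * (n - 1)) • (omitWedge (1 : Fin 3).castSucc (Fin.last 3) k *
      (omitWedge (0 : Fin 3).castSucc (Fin.last 3) j *
        omitWedge (2 : Fin 3).castSucc (Fin.last 3) l)) := by
  rw [tripleWedge, omitWedge_mul_comm, smul_mul_assoc, mul_assoc]

theorem tripleWedge_eq_two (j k l : Fin n) : tripleWedge j k l =
    omitWedge (2 : Fin 3).castSucc (Fin.last 3) l *
      (omitWedge (0 : Fin 3).castSucc (Fin.last 3) j *
        omitWedge (1 : Fin 3).castSucc (Fin.last 3) k) := by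
  rw [tripleWedge, mul_assoc, omitWedge_mul_comm, mul_smul_comm, ← mul_assoc,
    omitWedge_mul_comm (0 : Fin 3).castSucc, smul_mul_assoc, smul_smul, even_sign ⟨_, rfl⟩,
    one_smul, mul_assoc]

theorem fiberComponentLin_ι_theta_mul (a b c : Fin 3) (i j k l : Fin n) :
    fiberComponentLin 3 n (dzLast 3 n * (ExteriorAlgebra.ι ℂ (theta a.castSucc (Fin.last 3) i) *
      (omitWedge a.castSucc (Fin.last 3) j *
        (omitWedge b.castSucc (Fin.last 3) k * omitWedge c.castSucc (Fin.last 3) l)))) =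
      if i = j then ((-1 : ℂ) ^ (j : ℕ) * fiberConst n) • (omitWedge b a k * omitWedge c a l)
      else 0 := by
  rw [← mul_assoc (ExteriorAlgebra.ι ℂ _), ι_theta_mul_omitWedge]
  split_ifs with h
  · rw [smul_mul_assoc, mul_smul_comm, map_smul, fiberComponentLin_volWedge_mul, smul_smul]
  · rw [zero_mul, mul_zero, map_zero]

theorem dzbar_mul_fiberTerm (a : Fin 3) (i j k l : Fin n) :
    dzbar a i * fiberTerm j k l = fiberComponentLin 3 n
      (ExteriorAlgebra.ι ℂ (conjLin ∘ₗ coordFun a.castSucc i) *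
        (dzLast 3 n * tripleWedge j k l)) := by
  have h := fiberComponentLin_wedge_mul (m := 3) (n := n) (l := [()])
    (θ := fun _ => conjLin ∘ₗ coordFun a.castSucc i)
    (fun _ _ i' c => conj_coordFun_castSucc_coordVec a i i' c) (dzLast 3 n * tripleWedge j k l)
  rw [wedge_cons, wedge_nil, mul_one] at h
  rw [h, wedge_cons, wedge_nil, mul_one, LinearMap.comp_assoc, coordFun_castSucc_comp_horizontal]
  rfl

theorem ι_mul_dzLast_mul (t : Cotangent (Fin 4 → Fin n → ℂ)) (η : Ext (Fin 4 → Fin n → ℂ)) :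
    ExteriorAlgebra.ι ℂ t * (dzLast 3 n * η) =
      (-1 : ℂ) ^ n • (dzLast 3 n * (ExteriorAlgebra.ι ℂ t * η)) := by
  rw [dzLast, ← mul_assoc, ι_mul_wedge, List.length_finRange, smul_mul_assoc, mul_assoc]

/-- Sums `∑_a dz̄^a_i T_a` with `∑_a T_a = 0` only involve the differences `dz̄^a_i - dz̄^4_i`. -/
theorem sum_smul_dzbar_mul_fiberTerm {T : Fin 3 → ℂ} (hT : ∑ a, T a = 0) (i j k l : Fin n) :
    ∑ a, T a • (dzbar a i * fiberTerm j k l) = ∑ a, ((-1 : ℂ) ^ n * T a) •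
      fiberComponentLin 3 n (dzLast 3 n *
        (ExteriorAlgebra.ι ℂ (theta a.castSucc (Fin.last 3) i) * tripleWedge j k l)) := by
  -- Split dz̄^a_i as (dz̄^a_i − dz̄^4_i) + dz̄^4_i. The second part is multiplied by a form
  -- independent of a, so its total coefficient is ∑ T_a = 0.
  have h : ∀ a : Fin 3, T a • (dzbar a i * fiberTerm j k l) =
      ((-1 : ℂ) ^ n * T a) • fiberComponentLin 3 n (dzLast 3 n *
        (ExteriorAlgebra.ι ℂ (theta a.castSucc (Fin.last 3) i) * tripleWedge j k l)) +
      T a • fiberComponentLin 3 n (ExteriorAlgebra.ι ℂ (conjLin ∘ₗ coordFun (Fin.last 3) i) *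
        (dzLast 3 n * tripleWedge j k l)) := fun a => by
    rw [dzbar_mul_fiberTerm, mul_comm ((-1 : ℂ) ^ n), mul_smul, ← smul_add,
      ← map_smul (fiberComponentLin 3 n) ((-1 : ℂ) ^ n), ← ι_mul_dzLast_mul, ← map_add, ← add_mul, ← map_add, theta, sub_add_cancel]
  simp only [h, Finset.sum_add_distrib, ← Finset.sum_smul, hT, zero_smul, add_zero]

/-- The three factors are the normalisation of ω, the fiber volume constant and the mass of the
delta function. The sign is the product of (−1)^{j+1} in `bmCoeff` and (−1)^j from reinserting the
omitted covector. -/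
theorem bmConst_mul_fiberConst :
    -(bmConst n * fiberConst n * ((Real.pi ^ n / (n - 1).factorial : ℝ) : ℂ)) = 1 := by
  have h1 : ((n - 1).factorial : ℂ) ≠ 0 := by exact_mod_cast (n - 1).factorial_ne_zero
  have h2 : (Real.pi : ℂ) ≠ 0 := by exact_mod_cast Real.pi_ne_zero
  have h3 : (-1 : ℂ) ^ (n * (n - 1) / 2) * (-1) ^ (n * (n - 1) / 2) = 1 := by
    rw [← mul_pow]; simp
  have h4 : (2 * Real.pi * Complex.I : ℂ) ^ n = (2 * Complex.I) ^ n * Real.pi ^ n := by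
    rw [← mul_pow]; ring
  rw [bmConst, fiberConst, h4, pow_succ]
  push_cast
  generalize (-1 : ℂ) ^ (n * (n - 1) / 2) = s at h3
  have h5 : (2 * Complex.I) ^ n ≠ 0 := pow_ne_zero _ (by simp)
  field_simp
  linear_combination h3

/-- The kernel has degree n + 3(n−1) = 4n − 3 and contraction removes 2n. Its only holomorphic
covectors are the dz^4_i, which die on horizontal vectors, so the result has type (0, 2n−3). -/
theorem fiberTerm_mem (hn : 1 ≤ n) (j k l : Fin n) :
    fiberTerm j k l ∈ bidegree 3 n 0 (2 * (n : ℤ) - 3) := by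
  set S : Submodule ℂ (Ext (Fin 4 → Fin n → ℂ)) := Submodule.span ℂ
    (Set.range (fun i => dz (Fin.last 3) i) ∪
      Set.range fun s : Fin 4 × Fin n => dzbar s.1 s.2) with hS
  have hSι : S ≤ LinearMap.range (ExteriorAlgebra.ι ℂ) := by
    refine Submodule.span_le.2 ?_
    rintro _ (⟨i, rfl⟩ | ⟨s, rfl⟩)
    · exact ⟨_, rfl⟩
    · exact ⟨_, rfl⟩
  have hbar : ∀ (a : Fin 4) i, dzbar a i ∈ S := fun a i => Submodule.subset_span (Or.inr ⟨(a, i), rfl⟩)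
  have hth : ∀ (a b : Fin 4) i, ExteriorAlgebra.ι ℂ (theta a b i) ∈ S := fun a b i => by
    rw [theta, map_sub]
    exact Submodule.sub_mem _ (hbar a i) (hbar b i)
  have hom : ∀ (a b : Fin 4) (j : Fin n), omitWedge a b j ∈ S ^ (n - 1) := fun a b j => by
    have h := wedge_mem_pow (l := (List.finRange n).filter (fun k => k ≠ j))
      fun k _ => hth a b k
    rwa [length_finRange_filter] at h
  have hdz : dzLast 3 n ∈ S ^ n := by
    have h := wedge_mem_pow (S := S) (θ := fun i => coordFun (Fin.last 3) i)
      (l := List.finRange n) fun k _ => Submodule.subset_span (Or.inl ⟨k, rfl⟩)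
    rwa [List.length_finRange] at h
  have hall : dzLast 3 n * tripleWedge j k l ∈ zpowSubmodule S (4 * (n : ℤ) - 3) := by
    have h := Submodule.mul_mem_mul hdz (Submodule.mul_mem_mul
      (Submodule.mul_mem_mul (hom (0 : Fin 3).castSucc (Fin.last 3) j)
        (hom (1 : Fin 3).castSucc (Fin.last 3) k)) (hom (2 : Fin 3).castSucc (Fin.last 3) l))
    rw [← pow_add, ← pow_add, ← pow_add] at h
    have e : (4 * (n : ℤ) - 3).toNat = n + (n - 1 + (n - 1) + (n - 1)) := by omega
    rw [zpowSubmodule, if_pos (by omega), e]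
    exact h
  have h := contractList_mem (m := 3) hSι (List.finRange n) hall
  rw [List.length_finRange, show 4 * (n : ℤ) - 3 - 2 * n = 2 * n - 3 by ring] at h
  rw [bidegree_zero]
  refine extComap_mem (horizontal 3 n) (fun s hs => ?_) h
  suffices hle : S ≤ (Submodule.span ℂ (Set.range fun s : Fin 3 × Fin n =>
      dzbar s.1 s.2)).comap (extComap (horizontal 3 n)).toLinearMap from hle hs
  refine Submodule.span_le.2 ?_
  rintro _ (⟨i, rfl⟩ | ⟨⟨a, i⟩, rfl⟩)
  · have : extComap (horizontal 3 n) (dz (Fin.last 3) i) = 0 := by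
      rw [dz, covector, extComap_ι, coordFun_last_comp_horizontal, map_zero]
    simp only [SetLike.mem_coe, Submodule.mem_comap, AlgHom.toLinearMap_apply, this,
      Submodule.zero_mem]
  · simp only [SetLike.mem_coe, Submodule.mem_comap, AlgHom.toLinearMap_apply]
    rw [dzbar, covector, extComap_ι, LinearMap.comp_assoc]
    refine Fin.lastCases ?_ (fun b => ?_) a
    · rw [coordFun_last_comp_horizontal, LinearMap.comp_zero, map_zero]
      exact Submodule.zero_mem _
    · rw [coordFun_castSucc_comp_horizontal]
      exact Submodule.subset_span ⟨(b, i), rfl⟩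

end OmegaAlgebra

/-! ### The fiber integral of the kernel and its Dolbeault differential -/

section Arnold

variable {n : ℕ}

/-- The coefficient `s_j s_k s_l` of `K_j K_k K_l`. -/
noncomputable def tripleCoeff (p : Fin n × Fin n × Fin n) : ℂ :=
  bmCoeff p.1 * bmCoeff p.2.1 * bmCoeff p.2.2

/-- A triple as a function on `Fin 3`. -/
def tripleIndex (p : Fin n × Fin n × Fin n) : Fin 3 → Fin n := ![p.1, p.2.1, p.2.2]

theorem sum_smul_mul_triple {A : Type*} [Ring A] [Algebra ℂ A] (a b c : Fin n → ℂ)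
    (u v w : Fin n → A) :
    (∑ j, a j • u j) * (∑ k, b k • v k) * (∑ l, c l • w l) =
      ∑ p : Fin n × Fin n × Fin n, (a p.1 * b p.2.1 * c p.2.2) • (u p.1 * v p.2.1 * w p.2.2) := by
  rw [mul_assoc, sum_smul_mul_sum_smul, Finset.sum_mul, Fintype.sum_prod_type]
  refine Finset.sum_congr rfl fun j _ => ?_
  rw [Fintype.sum_prod_type, Finset.mul_sum]
  refine Finset.sum_congr rfl fun k _ => ?_
  rw [Finset.mul_sum]
  refine Finset.sum_congr rfl fun l _ => ?_
  rw [smul_mul_smul_comm, mul_assoc, mul_assoc]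

theorem fiberComponent_arnoldKernel (x : Fin 3 → Fin n → ℂ) (z : Fin n → ℂ) :
    fiberComponent (arnoldKernel n (addPoint x z)) =
      ∑ p : Fin n × Fin n × Fin n, kernelProd (tripleIndex p) x z •
        (tripleCoeff p • fiberTerm p.1 p.2.1 p.2.2) := by
  have h : arnoldKernel n (addPoint x z) = dzLast 3 n *
      (omegaPair (0 : Fin 3).castSucc (Fin.last 3) (addPoint x z) *
        omegaPair (1 : Fin 3).castSucc (Fin.last 3) (addPoint x z) *
        omegaPair (2 : Fin 3).castSucc (Fin.last 3) (addPoint x z)) := rfl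
  rw [fiberComponent_eq, h]
  simp only [omegaPair_eq, addPoint_castSucc, addPoint_last]
  rw [sum_smul_mul_triple, Finset.mul_sum, map_sum]
  refine Finset.sum_congr rfl fun p _ => ?_
  rw [mul_smul_comm, map_smul, fiberTerm, tripleWedge, smul_smul]
  congr 1
  simp only [kernelProd, Fin.prod_univ_three, tripleIndex, tripleCoeff, Matrix.cons_val]
  ring

/-- The fiber omits only finitely many points, which are null because n ≥ 1; integrals over it are
integrals over ℂⁿ. -/
theorem ae_mem_fiber {m : ℕ} (hn : 1 ≤ n) {x : Fin m → Fin n → ℂ} (hx : x ∈ Conf m n) :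
    ∀ᵐ z, z ∈ fiber x := by
  have : Nonempty (Fin n) := ⟨⟨0, hn⟩⟩
  have h : ∀ᵐ z : Fin n → ℂ, ∀ a, z ≠ x a := ae_all_iff.2 fun a => by simp [ae_iff]
  filter_upwards [h] with z hz
  intro a b
  refine Fin.lastCases ?_ (fun a' hab => ?_) a
  · refine Fin.lastCases (fun h => absurd rfl h) (fun b' _ => ?_) b
    rw [addPoint_last, addPoint_castSucc]
    exact hz b'
  · revert hab
    refine Fin.lastCases (fun _ => ?_) (fun b' hab => ?_) b
    · rw [addPoint_last, addPoint_castSucc]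
      exact (hz a').symm
    · rw [addPoint_castSucc, addPoint_castSucc]
      exact hx a' b' fun h => hab (by rw [h])

theorem restrict_fiber {m : ℕ} (hn : 1 ≤ n) {x : Fin m → Fin n → ℂ} (hx : x ∈ Conf m n) :
    (volume : Measure (Fin n → ℂ)).restrict (fiber x) = volume :=
  Measure.restrict_eq_self_of_ae_mem (ae_mem_fiber hn hx)

theorem coord_fiberComponent_arnoldKernel (x : Fin 3 → Fin n → ℂ) (z : Fin n → ℂ) :
    coord (Fin 3 → Fin n → ℂ) (fiberComponent (arnoldKernel n (addPoint x z))) =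
      ∑ p : Fin n × Fin n × Fin n, kernelProd (tripleIndex p) x z •
        coord (Fin 3 → Fin n → ℂ) (tripleCoeff p • fiberTerm p.1 p.2.1 p.2.2) := by
  rw [fiberComponent_arnoldKernel, map_sum]
  simp only [map_smul (coord (Fin 3 → Fin n → ℂ)) (kernelProd _ x z)]

theorem fiberIntegrable_arnoldKernel (hn : 1 ≤ n) {x : Fin 3 → Fin n → ℂ} (hx : x ∈ Conf 3 n) :
    FiberIntegrable (arnoldKernel n) x := by
  rw [FiberIntegrable, IntegrableOn, restrict_fiber hn hx]
  simp only [coord_fiberComponent_arnoldKernel]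
  exact integrable_finsetSum _ fun p _ => (integrable_kernelProd hn (tripleIndex p) hx).smul_const _

theorem fiberIntegral_arnoldKernel (hn : 1 ≤ n) {x : Fin 3 → Fin n → ℂ} (hx : x ∈ Conf 3 n) :
    fiberIntegral (arnoldKernel n) x =
      ∑ p : Fin n × Fin n × Fin n, kernelIntegral (tripleIndex p) x •
        (tripleCoeff p • fiberTerm p.1 p.2.1 p.2.2) := by
  rw [fiberIntegral, restrict_fiber hn hx]
  simp only [coord_fiberComponent_arnoldKernel]
  rw [integral_finsetSum _ fun p _ =>
    (integrable_kernelProd hn (tripleIndex p) hx).smul_const _]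
  simp only [integral_smul_const]
  rw [map_sum]
  simp only [map_smul (coord (Fin 3 → Fin n → ℂ)).symm (integral _ _), kernelIntegral,
    LinearEquiv.symm_apply_apply]

theorem smoothFormOn_sum_smul {ι E : Type*} [Fintype ι] [NormedAddCommGroup E] [NormedSpace ℝ E]
    [FiniteDimensional ℝ E] {U : Set E} {g : ι → E → ℂ} (hg : ∀ p, ContDiffOn ℝ ∞ (g p) U)
    (e : ι → Ext E) {α : E → Ext E} (hα : ∀ x ∈ U, α x = ∑ p, g p x • e p) :
    SmoothFormOn U α := by
  have h : ContDiffOn ℝ ∞ (fun x => ∑ p, g p x • coord E (e p)) U :=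
    ContDiffOn.sum fun p _ => (hg p).smul contDiffOn_const
  refine h.congr fun x hx => ?_
  rw [hα x hx, map_sum]
  simp only [map_smul (coord E) (g _ x)]

theorem coeffDeriv_sum_smul {ι E : Type*} [Fintype ι] [NormedAddCommGroup E] [NormedSpace ℝ E]
    [FiniteDimensional ℝ E] {x : E} {g : ι → E → ℂ} (hg : ∀ p, DifferentiableAt ℝ (g p) x)
    (e : ι → Ext E) {α : E → Ext E} (hα : α =ᶠ[𝓝 x] fun x => ∑ p, g p x • e p) (v : E) :
    coeffDeriv α x v = ∑ p, fderiv ℝ (g p) x v • e p := by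
  have h1 : (fun y => coord E (α y)) =ᶠ[𝓝 x] fun y => ∑ p, g p y • coord E (e p) := by
    filter_upwards [hα] with y hy
    rw [hy, map_sum]
    simp only [map_smul (coord E) (g _ y)]
  have h2 := HasFDerivAt.fun_sum (u := Finset.univ)
    fun p _ => (hg p).hasFDerivAt.smul_const (coord E (e p))
  rw [coeffDeriv, h1.fderiv_eq, h2.fderiv, _root_.sum_apply, map_sum]
  simp only [ContinuousLinearMap.smulRight_apply, map_smul (coord E).symm (fderiv ℝ (g _) x v),
    LinearEquiv.symm_apply_apply]

/-- `∂g/∂z̄^a_i`. -/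
noncomputable def scalarPartialBar {m : ℕ} (a : Fin m) (i : Fin n) (g : (Fin m → Fin n → ℂ) → ℂ)
    (x : Fin m → Fin n → ℂ) : ℂ :=
  (1 / 2 : ℂ) * (fderiv ℝ g x (coordVec a i 1) + Complex.I * fderiv ℝ g x (coordVec a i Complex.I))

theorem partialBar_sum_smul {ι : Type*} [Fintype ι] {m : ℕ} {x : Fin m → Fin n → ℂ}
    {g : ι → (Fin m → Fin n → ℂ) → ℂ} (hg : ∀ p, DifferentiableAt ℝ (g p) x)
    (e : ι → Ext (Fin m → Fin n → ℂ)) {α : (Fin m → Fin n → ℂ) → Ext (Fin m → Fin n → ℂ)}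
    (hα : α =ᶠ[𝓝 x] fun x => ∑ p, g p x • e p) (a : Fin m) (i : Fin n) :
    partialBar a i α x = ∑ p, scalarPartialBar a i (g p) x • e p := by
  rw [partialBar, coeffDeriv_sum_smul hg e hα, coeffDeriv_sum_smul hg e hα, Finset.smul_sum,
    ← Finset.sum_add_distrib, Finset.smul_sum]
  refine Finset.sum_congr rfl fun p _ => ?_
  rw [smul_smul, ← add_smul, smul_smul, scalarPartialBar]

theorem sum_scalarPartialBar_kernelIntegral (hn : 1 ≤ n) (i : Fin 3 → Fin n)
    {x : Fin 3 → Fin n → ℂ} (hx : x ∈ Conf 3 n) (j : Fin n) :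
    ∑ a, scalarPartialBar a j (kernelIntegral i) x = 0 := by
  simp only [scalarPartialBar]
  rw [← Finset.mul_sum, Finset.sum_add_distrib, ← Finset.mul_sum,
    sum_fderiv_kernelIntegral hn i hx, sum_fderiv_kernelIntegral hn i hx]
  simp

/-- Common bookkeeping for the three boundary terms: the signs depending on j cancel, leaving the
plain divergence of D, and the constants multiply to 1. -/
theorem sum_smul_diagonal {A : Type*} [AddCommGroup A] [Module ℂ A] {D : Fin n → Fin n → Fin n → ℂ}
    {P : Fin n → Fin n → ℂ}
    (hD : ∀ k l, ∑ j, D j k l = ((Real.pi ^ n / (n - 1).factorial : ℝ) : ℂ) * P k l)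
    (W : Fin n → Fin n → A) :
    ∑ k, ∑ l, ∑ j, (bmCoeff j * bmCoeff k * bmCoeff l * D j k l) •
        (((-1 : ℂ) ^ (j : ℕ) * fiberConst n) • W k l) =
      ∑ k, ∑ l, (bmCoeff k * bmCoeff l * P k l) • W k l := by
  refine Finset.sum_congr rfl fun k _ => Finset.sum_congr rfl fun l _ => ?_
  have h : ∀ j : Fin n, bmCoeff j * bmCoeff k * bmCoeff l * D j k l *
      ((-1 : ℂ) ^ (j : ℕ) * fiberConst n) =
      -(bmConst n * fiberConst n) * (bmCoeff k * bmCoeff l) * D j k l := fun j => by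
    have h1 : (-1 : ℂ) ^ (j : ℕ) * (-1) ^ (j : ℕ) = 1 := by rw [← mul_pow]; simp
    rw [bmCoeff, pow_succ]
    linear_combination -(bmConst n * bmCoeff k * bmCoeff l * D j k l * fiberConst n) * h1
  simp only [smul_smul, h]
  rw [← Finset.sum_smul, ← Finset.mul_sum, hD]
  congr 1
  linear_combination bmCoeff k * bmCoeff l * P k l * bmConst_mul_fiberConst (n := n)

theorem sum_scalarPartialBar_zero (hn : 1 ≤ n) {x : Fin 3 → Fin n → ℂ} (hx : x ∈ Conf 3 n)
    (k l : Fin n) :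
    ∑ j, scalarPartialBar 0 j (kernelIntegral (tripleIndex (j, k, l))) x =
      ((Real.pi ^ n / (n - 1).factorial : ℝ) : ℂ) *
        (bmKernel 0 k (x 1 - x 0) * bmKernel 0 l (x 2 - x 0)) := by
  -- The first entry of the triple is a dummy, overwritten by the summation index.
  have h := sum_wirtinger_kernelIntegral hn (tripleIndex (k, k, l)) hx 0
  have hu : ∀ j, Function.update (tripleIndex (k, k, l)) 0 j = tripleIndex (j, k, l) := fun j => by
    funext b; fin_cases b <;> simp [tripleIndex]
  have he : (Finset.univ : Finset (Fin 3)).erase 0 = {1, 2} := by decide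
  simp only [hu, kernelProdErase, he] at h
  rw [Finset.prod_pair (by decide)] at h
  exact h

theorem sum_scalarPartialBar_one (hn : 1 ≤ n) {x : Fin 3 → Fin n → ℂ} (hx : x ∈ Conf 3 n)
    (j l : Fin n) :
    ∑ k, scalarPartialBar 1 k (kernelIntegral (tripleIndex (j, k, l))) x =
      ((Real.pi ^ n / (n - 1).factorial : ℝ) : ℂ) *
        (bmKernel 0 j (x 0 - x 1) * bmKernel 0 l (x 2 - x 1)) := by
  have h := sum_wirtinger_kernelIntegral hn (tripleIndex (j, j, l)) hx 1
  have hu : ∀ k, Function.update (tripleIndex (j, j, l)) 1 k = tripleIndex (j, k, l) := fun k => by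
    funext b; fin_cases b <;> simp [tripleIndex]
  have he : (Finset.univ : Finset (Fin 3)).erase 1 = {0, 2} := by decide
  simp only [hu, kernelProdErase, he] at h
  rw [Finset.prod_pair (by decide)] at h
  exact h

theorem sum_scalarPartialBar_two (hn : 1 ≤ n) {x : Fin 3 → Fin n → ℂ} (hx : x ∈ Conf 3 n)
    (j k : Fin n) :
    ∑ l, scalarPartialBar 2 l (kernelIntegral (tripleIndex (j, k, l))) x =
      ((Real.pi ^ n / (n - 1).factorial : ℝ) : ℂ) *
        (bmKernel 0 j (x 0 - x 2) * bmKernel 0 k (x 1 - x 2)) := by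
  have h := sum_wirtinger_kernelIntegral hn (tripleIndex (j, k, k)) hx 2
  have hu : ∀ l, Function.update (tripleIndex (j, k, k)) 2 l = tripleIndex (j, k, l) := fun l => by
    funext b; fin_cases b <;> simp [tripleIndex]
  have he : (Finset.univ : Finset (Fin 3)).erase 2 = {0, 1} := by decide
  simp only [hu, kernelProdErase, he] at h
  rw [Finset.prod_pair (by decide)] at h
  exact h

/-- The contribution of the point `z^a` to the Dolbeault differential of the fiber integral. -/
noncomputable def boundaryTerm (x : Fin 3 → Fin n → ℂ) (a : Fin 3) : Ext (Fin 3 → Fin n → ℂ) :=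
  ∑ p : Fin n × Fin n × Fin n, ∑ i,
    (tripleCoeff p * scalarPartialBar a i (kernelIntegral (tripleIndex p)) x) •
      fiberComponentLin 3 n (dzLast 3 n *
        (ExteriorAlgebra.ι ℂ (theta a.castSucc (Fin.last 3) i) * tripleWedge p.1 p.2.1 p.2.2))

theorem boundaryTerm_zero (hn : 1 ≤ n) {x : Fin 3 → Fin n → ℂ} (hx : x ∈ Conf 3 n) :
    boundaryTerm x 0 = omegaPair 1 0 x * omegaPair 2 0 x := by
  have h := sum_smul_diagonal (fun k l => sum_scalarPartialBar_zero hn hx k l)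
    fun k l => omitWedge (1 : Fin 3) 0 k * omitWedge (2 : Fin 3) 0 l
  simp only [boundaryTerm, tripleWedge, mul_assoc (omitWedge _ _ _),
    fiberComponentLin_ι_theta_mul, smul_ite, smul_zero, Finset.sum_ite_eq', Finset.mem_univ,
    if_true, Fintype.sum_prod_type, tripleCoeff]
  rw [Finset.sum_comm, Finset.sum_congr rfl fun k _ => Finset.sum_comm, h, omegaPair_mul_eq]
  refine Finset.sum_congr rfl fun k _ => Finset.sum_congr rfl fun l _ => ?_
  congr 1
  ring

/-- The sign comes from moving the factor of degree n − 1 belonging to the second point past that of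
the first; for the third point two such signs cancel. -/
theorem boundaryTerm_one (hn : 1 ≤ n) {x : Fin 3 → Fin n → ℂ} (hx : x ∈ Conf 3 n) :
    boundaryTerm x 1 =
      (-1 : ℂ) ^ ((n - 1) * (n - 1)) • (omegaPair 0 1 x * omegaPair 2 1 x) := by
  have h := sum_smul_diagonal
    (D := fun k j l => scalarPartialBar 1 k (kernelIntegral (tripleIndex (j, k, l))) x)
    (fun j l => sum_scalarPartialBar_one hn hx j l)
    fun j l => omitWedge (0 : Fin 3) 1 j * omitWedge (2 : Fin 3) 1 l
  simp only [boundaryTerm, tripleWedge_eq_one, mul_smul_comm, map_smul,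
    fiberComponentLin_ι_theta_mul, smul_ite, smul_zero, Finset.sum_ite_eq', Finset.mem_univ,
    if_true, Fintype.sum_prod_type, tripleCoeff]
  refine Eq.trans ?_ (congrArg (fun u => (-1 : ℂ) ^ ((n - 1) * (n - 1)) • u) (h.trans ?_))
  · rw [Finset.smul_sum]
    refine Finset.sum_congr rfl fun j _ => ?_
    rw [Finset.sum_comm, Finset.smul_sum]
    refine Finset.sum_congr rfl fun l _ => ?_
    rw [Finset.smul_sum]
    refine Finset.sum_congr rfl fun k _ => ?_
    rw [mul_comm (bmCoeff j), smul_comm]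
  · rw [omegaPair_mul_eq]
    refine Finset.sum_congr rfl fun k _ => Finset.sum_congr rfl fun l _ => ?_
    congr 1
    ring

theorem boundaryTerm_two (hn : 1 ≤ n) {x : Fin 3 → Fin n → ℂ} (hx : x ∈ Conf 3 n) :
    boundaryTerm x 2 = omegaPair 0 2 x * omegaPair 1 2 x := by
  have h := sum_smul_diagonal
    (D := fun l j k => scalarPartialBar 2 l (kernelIntegral (tripleIndex (j, k, l))) x)
    (fun j k => sum_scalarPartialBar_two hn hx j k)
    fun j k => omitWedge (0 : Fin 3) 2 j * omitWedge (1 : Fin 3) 2 k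
  simp only [boundaryTerm, tripleWedge_eq_two,
    fiberComponentLin_ι_theta_mul, smul_ite, smul_zero, Finset.sum_ite_eq', Finset.mem_univ,
    if_true, Fintype.sum_prod_type, tripleCoeff]
  refine Eq.trans ?_ (h.trans ?_)
  · refine Finset.sum_congr rfl fun j _ => Finset.sum_congr rfl fun k _ =>
      Finset.sum_congr rfl fun l _ => ?_
    rw [mul_comm (bmCoeff j * bmCoeff k), mul_assoc (bmCoeff l) (bmCoeff j)]
  · rw [omegaPair_mul_eq]
    refine Finset.sum_congr rfl fun k _ => Finset.sum_congr rfl fun l _ => ?_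
    congr 1
    ring

theorem dbar_fiberIntegral_eq_boundaryTerm (hn : 1 ≤ n) {x : Fin 3 → Fin n → ℂ}
    (hx : x ∈ Conf 3 n) :
    dbar (fiberIntegral (arnoldKernel n)) x = (-1 : ℂ) ^ n • ∑ a, boundaryTerm x a := by
  have hev : fiberIntegral (arnoldKernel n) =ᶠ[𝓝 x] fun x =>
      ∑ p : Fin n × Fin n × Fin n, kernelIntegral (tripleIndex p) x •
        (tripleCoeff p • fiberTerm p.1 p.2.1 p.2.2) := by
    filter_upwards [(isOpen_conf 3 n).mem_nhds hx] with y hy using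
      fiberIntegral_arnoldKernel hn hy
  have hd : ∀ p : Fin n × Fin n × Fin n,
      DifferentiableAt ℝ (kernelIntegral (tripleIndex p)) x := fun p =>
    ((contDiffOn_kernelIntegral hn _).contDiffAt
      ((isOpen_conf 3 n).mem_nhds hx)).differentiableAt (by simp)
  have hT : ∀ (p : Fin n × Fin n × Fin n) (i : Fin n), ∑ a, tripleCoeff p *
      scalarPartialBar a i (kernelIntegral (tripleIndex p)) x = 0 := fun p i => by
    rw [← Finset.mul_sum, sum_scalarPartialBar_kernelIntegral hn _ hx, mul_zero]
  have h1 : dbar (fiberIntegral (arnoldKernel n)) x =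
      ∑ p : Fin n × Fin n × Fin n, ∑ i, ∑ a, (tripleCoeff p *
        scalarPartialBar a i (kernelIntegral (tripleIndex p)) x) •
          (dzbar a i * fiberTerm p.1 p.2.1 p.2.2) := by
    simp only [dbar, partialBar_sum_smul hd _ hev, Finset.mul_sum, mul_smul_comm, smul_smul]
    rw [Finset.sum_congr rfl fun a _ => Finset.sum_comm, Finset.sum_comm]
    refine Finset.sum_congr rfl fun p _ => ?_
    rw [Finset.sum_comm]
    refine Finset.sum_congr rfl fun i _ => Finset.sum_congr rfl fun a _ => ?_
    rw [mul_comm]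
  -- Translation invariance enters here, through `hT`.
  rw [h1, Finset.sum_congr rfl fun p _ => Finset.sum_congr rfl fun i _ =>
    sum_smul_dzbar_mul_fiberTerm (hT p i) i p.1 p.2.1 p.2.2]
  simp only [mul_smul ((-1 : ℂ) ^ n), ← Finset.smul_sum, boundaryTerm]
  rw [Finset.sum_congr rfl fun p _ => Finset.sum_comm, Finset.sum_comm]

/-- Each boundary term needs one reversal of indices, with sign (−1)^n, and carries one sign
(−1)^{(n−1)²} = (−1)^{n−1} from commuting factors. With the overall (−1)^n this leaves (−1)^{n−1}.
-/
theorem dbar_fiberIntegral_arnoldKernel (hn : 1 ≤ n) {x : Fin 3 → Fin n → ℂ}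
    (hx : x ∈ Conf 3 n) :
    dbar (fiberIntegral (arnoldKernel n)) x = (-1 : ℂ) ^ (n - 1) • arnoldForm n x := by
  rw [dbar_fiberIntegral_eq_boundaryTerm hn hx, Fin.sum_univ_three, boundaryTerm_zero hn hx,
    boundaryTerm_one hn hx, boundaryTerm_two hn hx, arnoldForm, omegaPair_swap hn 0 1,
    omegaPair_swap hn 1 2, omegaPair_swap hn 2 0]
  simp only [smul_mul_assoc, mul_smul_comm]
  rw [omegaPair_mul_comm 0 1 2 0, omegaPair_mul_comm 2 0 1 2]
  have he : (-1 : ℂ) ^ ((n - 1) * (n - 1)) = (-1) ^ (n - 1) := by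
    rw [pow_mul]
    rcases Nat.even_or_odd (n - 1) with h | h <;> simp [h.neg_one_pow]
  have hs : (-1 : ℂ) ^ n * (-1) ^ n = 1 := by rw [← mul_pow]; simp
  rw [he]
  simp only [smul_add, smul_smul, ← mul_assoc, hs, one_mul]
  rw [mul_comm ((-1 : ℂ) ^ n) ((-1) ^ (n - 1)), mul_assoc, hs, mul_one]
  abel

theorem isForm_fiberIntegral_arnoldKernel (hn : 1 ≤ n) :
    IsForm 0 (2 * (n : ℤ) - 3) (Conf 3 n) (fiberIntegral (arnoldKernel n)) := by
  refine ⟨smoothFormOn_sum_smul (fun p => contDiffOn_kernelIntegral hn (tripleIndex p)) _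
    fun x hx => fiberIntegral_arnoldKernel hn hx, fun x hx => ?_⟩
  rw [fiberIntegral_arnoldKernel hn hx]
  exact Submodule.sum_mem _ fun p _ => Submodule.smul_mem _ _ (Submodule.smul_mem _ _
    (fiberTerm_mem hn _ _ _))

theorem dbar_const_smul {m : ℕ} {U : Set (Fin m → Fin n → ℂ)} (hU : IsOpen U)
    {α : (Fin m → Fin n → ℂ) → Ext (Fin m → Fin n → ℂ)} (hα : SmoothFormOn U α) (c : ℂ)
    {x : Fin m → Fin n → ℂ} (hx : x ∈ U) : dbar (fun y => c • α y) x = c • dbar α x := by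
  have hd : DifferentiableAt ℝ (fun y => coord (Fin m → Fin n → ℂ) (α y)) x :=
    (hα.contDiffAt (hU.mem_nhds hx)).differentiableAt (by simp)
  have h1 : ∀ v, coeffDeriv (fun y => c • α y) x v = c • coeffDeriv α x v := fun v => by
    simp only [coeffDeriv, map_smul (coord (Fin m → Fin n → ℂ)) c]
    rw [fderiv_fun_const_smul hd, _root_.smul_apply, map_smul]
  simp only [dbar, partialBar, h1, Finset.smul_sum]
  refine Finset.sum_congr rfl fun a _ => Finset.sum_congr rfl fun i _ => ?_
  rw [← mul_smul_comm]
  congr 1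
  module

theorem isDbarExact_arnoldForm (hn : 1 ≤ n) :
    IsDbarExact 0 (2 * (n : ℤ) - 2) (Conf 3 n) (arnoldForm n) := by
  have hF := isForm_fiberIntegral_arnoldKernel hn
  -- The sign is its own inverse, so this multiple of F is a primitive.
  refine ⟨fun y => (-1 : ℂ) ^ (n - 1) • fiberIntegral (arnoldKernel n) y, ⟨?_, ?_⟩, ?_⟩
  · have h := hF.1.const_smul ((-1 : ℂ) ^ (n - 1))
    refine h.congr fun x _ => ?_
    rw [map_smul]
  · intro x hx
    have e : 2 * (n : ℤ) - 2 - 1 = 2 * n - 3 := by ring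
    rw [e]
    exact Submodule.smul_mem _ _ (hF.2 x hx)
  · intro x hx
    rw [dbar_const_smul (isOpen_conf 3 n) hF.1 _ hx, dbar_fiberIntegral_arnoldKernel hn hx,
      smul_smul, ← mul_pow]
    simp

end Arnold

end DolbeaultConf

theorem mainTheorem10 (n : ℕ) (hn : 1 ≤ n) :
    DolbeaultConf.IsDbarExact 0 (2 * (n : ℤ) - 2) (DolbeaultConf.Conf 3 n)
        (DolbeaultConf.arnoldForm n) ∧
      (∀ x ∈ DolbeaultConf.Conf 3 n,
        DolbeaultConf.FiberIntegrable (DolbeaultConf.arnoldKernel n) x) ∧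
      DolbeaultConf.IsForm 0 (2 * (n : ℤ) - 3) (DolbeaultConf.Conf 3 n)
        (DolbeaultConf.fiberIntegral (DolbeaultConf.arnoldKernel n)) ∧
      (∀ x ∈ DolbeaultConf.Conf 3 n,
        DolbeaultConf.dbar (DolbeaultConf.fiberIntegral (DolbeaultConf.arnoldKernel n)) x =
          (-1 : ℂ) ^ (n - 1) • DolbeaultConf.arnoldForm n x) :=
  ⟨DolbeaultConf.isDbarExact_arnoldForm hn,
    fun _ hx => DolbeaultConf.fiberIntegrable_arnoldKernel hn hx,
    DolbeaultConf.isForm_fiberIntegral_arnoldKernel hn,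
    fun _ hx => DolbeaultConf.dbar_fiberIntegral_arnoldKernel hn hx⟩
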